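/- Let $\delta_L,\delta_R,\tau_L,\tau_R\in\mathbb R$ and let $f:\mathbb R^2\to\mathbb R^2$ be the border-collision normal form $$f(x,y)=\begin{cases}(\tau_L x+y+1,\;-\delta_L x), & x\le 0,\\ (\tau_R x+y+1,\;-\delta_R x), & x\ge 0.\end{cases}$$ Assume $0<\delta_L<1$, $0<\delta_R<1$, $\tau_L>\delta_L+1$, $\tau_R<-(\delta_R+1)$, $$\phi:=\delta_R-\bigl(\tau_R+\delta_L+\delta_R-(1+\tau_R)\lambda_L^u\bigr)\lambda_L^u>0,\qquad \tau_L>\frac{\delta_L+2}{\sqrt2},\qquad \tau_R<-\frac{\delta_R+2}{\sqrt2},$$ where $\lambda_L^u=\tfrac12\bigl(\tau_L+\sqrt{\tau_L^2-4\delta_L}\bigr)$. Let $X=\bigl(\tfrac{1}{\delta_R+1-\tau_R},\tfrac{-\delta_R}{\delta_R+1-\tau_R}\bigr)$ be the fixed point of $f$ in $x>0$. It is a saddle: the matrix $A_R=\begin{bmatrix}\tau_R&1\\-\delta_R&0\end{bmatrix}$ has eigenvalues $\lambda_R^u<-1<\lambda_R^s<0$. Let $E^s(X)$, $E^u(X)$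 be the lines through $X$ in the directions of the eigenvectors of $A_R$ for $\lambda_R^s$, $\lambda_R^u$. Let $W^s(X)$ be the set of points whose forward orbit converges to $X$, and $W^u(X)$ the set of points that have a backward orbit converging to $X$. Then $E^u(X)$ meets the line $y=0$ in a single point $T$, and the following hold. (i) $f^2(T)$ lies strictly to the left of $E^s(X)$. Consequently the segment from $T$ to $f^2(T)$ meets $E^s(X)$ in a single point $Z$, and $Z\neq X$ is a transverse homoclinic point of $X$: through $Z$ there are two line segments with $Z$ in their interiors and with linearly independent directions, one contained in $W^u(X)$ and the other in $W^s(X)$. Let $\Delta_0$ be the compact filled triangle $XTZ$, let $\Delta=\bigcup_{n\ge0}f^n(\Delta_0)$ and let $\tilde\Delta=\bigcap_{n\ge0}f^n(\Delta)$. (ii) $\displaystyle\bigcap_{n\ge0}f^n\bigl(\operatorname{cl}(\Delta)\bigr)=\operatorname{cl}\bigl(W^u(X)\bigr)=\operatorname{cl}\bigl(\tilde\Delta\bigr).$ (iii) $f$ is topologically transitive on $\operatorname{cl}(W^u(X))$ and on $\tilde\Delta$. Here $f$ is topologically transitive on a set $S$ if $f(S)\subseteq S$ and for all nonempty relatively open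 $M,N\subseteq S$ there is $n\ge0$ with $f^n(M)\cap N\ne\varnothing$. -/

import Mathlib

open Set Filter Topology

namespace BorderCollision

/-- The linear map of the plane with matrix `[[τ, 1], [-δ, 0]]`. -/
def A (τ δ : ℝ) (z : ℝ × ℝ) : ℝ × ℝ := (τ * z.1 + z.2, -δ * z.1)

/-- The two-dimensional border-collision normal form. The two pieces agree on `x = 0`. -/
noncomputable def f (τL δL τR δR : ℝ) (z : ℝ × ℝ) : ℝ × ℝ :=
  if z.1 ≤ 0 then A τL δL z + (1, 0) else A τR δR z + (1, 0)

/-- The eigenvalue `λ_L^u` of `A τL δL`: the larger root of `t ^ 2 - τL * t + δL`. -/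
noncomputable def lamLu (τL δL : ℝ) : ℝ := (τL + Real.sqrt (τL ^ 2 - 4 * δL)) / 2

/-- The eigenvalue `λ_R^s` of `A τR δR`: the larger root of `t ^ 2 - τR * t + δR`, which for
`δR > 0`, `τR < -(δR + 1)` is the one in `(-1, 0)`. -/
noncomputable def lamRs (τR δR : ℝ) : ℝ := (τR + Real.sqrt (τR ^ 2 - 4 * δR)) / 2

/-- The eigenvalue `λ_R^u` of `A τR δR`: the smaller root of `t ^ 2 - τR * t + δR`, which for
`δR > 0`, `τR < -(δR + 1)` is the one less than `-1`. -/
noncomputable def lamRu (τR δR : ℝ) : ℝ := (τR - Real.sqrt (τR ^ 2 - 4 * δR)) / 2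

/-- The function whose positivity cuts out the parameter region. -/
noncomputable def phi (τL δL τR δR : ℝ) : ℝ :=
  δR - (τR + δL + δR - (1 + τR) * lamLu τL δL) * lamLu τL δL

/-- The fixed point `X` of `f` in `x > 0`. -/
noncomputable def X (τR δR : ℝ) : ℝ × ℝ := (1 / (δR + 1 - τR), -δR / (δR + 1 - τR))

/-- The stable subspace of `X`: the line through `X` in the eigendirection of `λ_R^s`. -/
def Es (τR δR : ℝ) : Set (ℝ × ℝ) :=
  {z | A τR δR (z - X τR δR) = lamRs τR δR • (z - X τR δR)}

/-- The unstable subspace of `X`: the line through `X` in the eigendirection of `λ_R^u`. -/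
def Eu (τR δR : ℝ) : Set (ℝ × ℝ) :=
  {z | A τR δR (z - X τR δR) = lamRu τR δR • (z - X τR δR)}

/-- The stable manifold (stable set) of a point `p` under a map `g`: the points whose forward
orbit converges to `p`. -/
def Ws (g : ℝ × ℝ → ℝ × ℝ) (p : ℝ × ℝ) : Set (ℝ × ℝ) :=
  {z | Tendsto (fun n : ℕ => g^[n] z) atTop (𝓝 p)}

/-- The unstable manifold (unstable set) of a point `p` under a map `g`: the points that have a
backward orbit converging to `p`. -/
def Wu (g : ℝ × ℝ → ℝ × ℝ) (p : ℝ × ℝ) : Set (ℝ × ℝ) :=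
  {z | ∃ u : ℕ → ℝ × ℝ, u 0 = z ∧ (∀ n, g (u (n + 1)) = u n) ∧ Tendsto u atTop (𝓝 p)}

/-- The point `q` lies (strictly) to the left of the line `ℓ`: the horizontal line through `q`
meets `ℓ`, and only to the right of `q`. -/
def LiesLeftOf (q : ℝ × ℝ) (ℓ : Set (ℝ × ℝ)) : Prop :=
  (∃ p ∈ ℓ, p.2 = q.2) ∧ ∀ p ∈ ℓ, p.2 = q.2 → q.1 < p.1

/-- `z` is a transverse homoclinic point of `p`: it differs from `p`, and through `z` there are
line segments, with `z` in their interior and with linearly independent directions, one in the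
unstable and one in the stable manifold of `p`. (The manifolds of the piecewise-linear map are
piecewise linear.) -/
def IsTransverseHomoclinic (g : ℝ × ℝ → ℝ × ℝ) (p z : ℝ × ℝ) : Prop :=
  z ≠ p ∧ ∃ v w : ℝ × ℝ, LinearIndependent ℝ ![v, w] ∧ ∃ ε > 0, ∀ t : ℝ, |t| < ε →
    z + t • v ∈ Wu g p ∧ z + t • w ∈ Ws g p

/-- The union of the forward images of `S`. -/
def forwardUnion (g : ℝ × ℝ → ℝ × ℝ) (S : Set (ℝ × ℝ)) : Set (ℝ × ℝ) := ⋃ n : ℕ, g^[n] '' S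

/-- The intersection of the forward images of `S`. -/
def forwardInter (g : ℝ × ℝ → ℝ × ℝ) (S : Set (ℝ × ℝ)) : Set (ℝ × ℝ) := ⋂ n : ℕ, g^[n] '' S

/-- `g` is topologically transitive on `S`: it maps `S` to itself, and for any two nonempty
relatively open subsets `S ∩ M`, `S ∩ N` of `S` some iterate of the first meets the second. -/
def IsTransitiveOn (g : ℝ × ℝ → ℝ × ℝ) (S : Set (ℝ × ℝ)) : Prop :=
  MapsTo g S S ∧ ∀ M N : Set (ℝ × ℝ), IsOpen M → IsOpen N → (S ∩ M).Nonempty → (S ∩ N).Nonempty →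
    ∃ n : ℕ, (g^[n] '' (S ∩ M) ∩ (S ∩ N)).Nonempty

end BorderCollision

open BorderCollision

namespace BorderCollision

/-! Let `a > b > 0` and `-r < -c < 0` be the eigenvalues of the two pieces. The hypotheses give `a,
r > √2`, and the determinants `a * b`, `r * c` lie in `(0, 1)`, so the map is a homeomorphism that
contracts area.

Let `Y` be the fixed point in `x < 0`. Positivity of `phi` makes the triangle `trap`, built on the
eigenlines of `Y`, forward invariant (`mapsTo_trap`). With `a, r > √2` it also gives `b + c < 1`,
which puts the part of `x = 0` inside the triangle to the left of `Es` (`neg_lt_of_mem_trap`).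

Homoclinic point: `a, r > √2` gives `r < a * (r ^ 2 - 1)`, so the second image of `T` is to the left
of `Es` (`ξ_F_F_Tpt`). The segment from `T` to it is the image of a piece of the unstable line,
hence lies in `Wu` (`segment_subset_Wu`).

Transitivity: a segment with slope in `[-b, c]` is stretched horizontally by at least `min a r`. If
`x = 0` cuts it, the longer piece is kept, and the image of that piece has an end on `y = 0`. If `x
= 0` cuts this image again, a part of it joins `x = 0` to `y = 0` and must cross `Es`. Otherwise two
steps have gained a factor of at least `(min a r) ^ 2 / 2 > 1`. As `trap` is bounded, a crossing
occurs (`ConeSeg.exists_crossing`), after which the iterates accumulate on the unstable line near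
`X`, as in the inclination lemma (`Crossing.eventually_meets`). Images of that line fill `Wu`, so
orbits in `Wu` join any two open sets that meet it (`exists_iterate_mem`).

Closures: the sides `XT` and `TZ` of the triangle lie in `Wu`, and the side `XZ` is contracted to
`X`. A ball away from the closure of `Wu` is therefore missed by the boundaries of all late images
of the triangle. If such an image met the ball, it would contain it, although its area tends to `0`
(`forwardInter_closure_subset`). Conversely `Wu` is invariant, so it lies in every image of the
union. -/

/-- The parameter region, in terms of the absolute values `a > b` and `r > c` of the eigenvalues of
the two linear pieces. -/
structure Admissible (a b r c : ℝ) : Prop where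
  one_lt_a : 1 < a
  one_lt_r : 1 < r
  b_pos : 0 < b
  c_pos : 0 < c
  two_lt_a_sq : 2 < a ^ 2
  two_lt_r_sq : 2 < r ^ 2
  ab_lt : a * b < 1
  rc_lt : r * c < 1
  phi_pos : (r * c + a * (r + c)) * (a - 1) < a ^ 2 * (1 - b)

/-- The normal form, with its parameters expressed by the eigenvalues `a, b` and `-r, -c`. -/
noncomputable abbrev F (a b r c : ℝ) : ℝ × ℝ → ℝ × ℝ := f (a + b) (a * b) (-(r + c)) (r * c)

variable {a b r c : ℝ}

/-! ### Inequalities between the eigenvalues -/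

namespace Admissible

lemma b_lt (h : Admissible a b r c) : b < 1 := by
  nlinarith [h.ab_lt, h.one_lt_a, h.b_pos]

lemma c_lt (h : Admissible a b r c) : c < 1 := by
  nlinarith [h.rc_lt, h.one_lt_r, h.c_pos]

lemma two_lt_mul (h : Admissible a b r c) : 2 < a * r := by
  have h1 := h.two_lt_a_sq
  have h2 := h.two_lt_r_sq
  have h3 : 0 < a * r := mul_pos (by linarith [h.one_lt_a]) (by linarith [h.one_lt_r])
  have h4 : 2 * 2 < a ^ 2 * r ^ 2 := by gcongr
  nlinarith

lemma r_lt (h : Admissible a b r c) : r < a * (r ^ 2 - 1) := by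
  have h1 := h.two_lt_r_sq
  have h2 := h.two_lt_mul
  have := h.one_lt_a
  have := h.one_lt_r
  nlinarith [mul_pos (show 0 < r by linarith) (show 0 < a * r - 2 by linarith),
    mul_pos (show 0 < a by linarith) (show 0 < r ^ 2 - 2 by linarith)]

lemma a_lt (h : Admissible a b r c) : a < r * (a ^ 2 - 1) := by
  have h1 := h.two_lt_a_sq
  have h2 := h.two_lt_mul
  have := h.one_lt_a
  have := h.one_lt_r
  nlinarith [mul_pos (show 0 < a by linarith) (show 0 < a * r - 2 by linarith),
    mul_pos (show 0 < r by linarith) (show 0 < a ^ 2 - 2 by linarith)]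

lemma c_add_b_lt (h : Admissible a b r c) : c + b < 1 := by
  have h1 := h.phi_pos
  have h2 := h.a_lt
  have h3 := h.c_lt
  have h4 := h.c_pos
  have ha := h.one_lt_a
  have hr := h.one_lt_r
  -- The quantities in `h5` and `h6` add up to `(r * c + a * (r + c)) * (a - 1) - a ^ 2 * c`.
  have h5 : 0 < (1 - c) * (r * a * (a - 1)) := by
    have : 0 < a - 1 := by linarith
    have : 0 < 1 - c := by linarith
    positivity
  have h6 : 0 < c * (r * (a ^ 2 - 1) - a) := mul_pos h4 (by linarith)
  have h7 : a ^ 2 * c < a ^ 2 * (1 - b) := by nlinarith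
  have := lt_of_mul_lt_mul_left h7 (by positivity)
  linarith

end Admissible

/-! ### The map and its two affine branches -/

lemma F_left {z : ℝ × ℝ} (hz : z.1 ≤ 0) :
    F a b r c z = ((a + b) * z.1 + z.2 + 1, -(a * b) * z.1) := by
  simp [F, f, A, hz]

lemma F_right {z : ℝ × ℝ} (hz : 0 ≤ z.1) :
    F a b r c z = (-(r + c) * z.1 + z.2 + 1, -(r * c) * z.1) := by
  rcases hz.eq_or_lt with h | h
  · rw [F_left h.ge]; simp [← h]
  · simp [F, f, A, h.not_ge]

lemma continuous_F : Continuous (F a b r c) := by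
  unfold F f A
  refine Continuous.if_le (by fun_prop) (by fun_prop) (by fun_prop) (by fun_prop) ?_
  intro z hz
  simp [hz]

/-- The normal form as a homeomorphism of the plane. -/
noncomputable def homeoF (h : Admissible a b r c) : ℝ × ℝ ≃ₜ ℝ × ℝ where
  toFun := F a b r c
  -- The second coordinate of an image has sign opposite to `x`, so it selects the branch to invert.
  invFun z := if 0 ≤ z.2 then (-z.2 / (a * b), z.1 - 1 + (a + b) * (z.2 / (a * b)))
    else (-z.2 / (r * c), z.1 - 1 - (r + c) * (z.2 / (r * c)))
  left_inv z := by
    have ha : 0 < a := by linarith [h.one_lt_a]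
    have hb := h.b_pos
    have hr : 0 < r := by linarith [h.one_lt_r]
    have hc := h.c_pos
    have hab : 0 < a * b := by positivity
    have hrc : 0 < r * c := by positivity
    rcases le_or_gt z.1 0 with hz | hz
    · rw [F_left hz]
      dsimp only
      rw [if_pos (by nlinarith)]
      ext <;> simp <;> field_simp
      ring
    · rw [F_right hz.le]
      dsimp only
      rw [if_neg (by simpa using mul_pos hrc hz)]
      ext <;> simp <;> field_simp
      ring
  right_inv z := by
    have ha : 0 < a := by linarith [h.one_lt_a]
    have hb := h.b_pos
    have hr : 0 < r := by linarith [h.one_lt_r]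
    have hc := h.c_pos
    have hab : 0 < a * b := by positivity
    have hrc : 0 < r * c := by positivity
    dsimp only
    split_ifs with hz
    · rw [F_left (by simpa [neg_div] using div_nonneg hz hab.le)]
      ext <;> simp <;> field_simp
      ring
    · have : 0 ≤ -z.2 / (r * c) := div_nonneg (by linarith) hrc.le
      rw [F_right (by simpa using this)]
      ext <;> simp <;> field_simp
      ring
  continuous_toFun := continuous_F
  continuous_invFun := by
    refine Continuous.if_le (by fun_prop) (by fun_prop) (by fun_prop) (by fun_prop) ?_
    intro z hz
    simp [← hz]

lemma coe_homeoF (h : Admissible a b r c) : ⇑(homeoF h) = F a b r c := rfl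

lemma F_combo_left {p q : ℝ × ℝ} (hp : p.1 ≤ 0) (hq : q.1 ≤ 0) {s t : ℝ} (hs : 0 ≤ s)
    (ht : 0 ≤ t) (hst : s + t = 1) :
    F a b r c (s • p + t • q) = s • F a b r c p + t • F a b r c q := by
  have : (s • p + t • q).1 ≤ 0 := by
    simp only [Prod.fst_add, Prod.smul_fst, smul_eq_mul]; nlinarith
  rw [F_left this, F_left hp, F_left hq]
  obtain rfl : t = 1 - s := by linarith
  ext <;> simp <;> ring

lemma F_combo_right {p q : ℝ × ℝ} (hp : 0 ≤ p.1) (hq : 0 ≤ q.1) {s t : ℝ} (hs : 0 ≤ s)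
    (ht : 0 ≤ t) (hst : s + t = 1) :
    F a b r c (s • p + t • q) = s • F a b r c p + t • F a b r c q := by
  have : 0 ≤ (s • p + t • q).1 := by
    simp only [Prod.fst_add, Prod.smul_fst, smul_eq_mul]; positivity
  rw [F_right this, F_right hp, F_right hq]
  obtain rfl : t = 1 - s := by linarith
  ext <;> simp <;> ring

lemma segment_subset_image_left {p q : ℝ × ℝ} (hp : p.1 ≤ 0) (hq : q.1 ≤ 0) :
    segment ℝ (F a b r c p) (F a b r c q) ⊆ F a b r c '' segment ℝ p q := by
  rintro _ ⟨s, t, hs, ht, hst, rfl⟩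
  exact ⟨s • p + t • q, ⟨s, t, hs, ht, hst, rfl⟩, F_combo_left hp hq hs ht hst⟩

lemma segment_subset_image_right {p q : ℝ × ℝ} (hp : 0 ≤ p.1) (hq : 0 ≤ q.1) :
    segment ℝ (F a b r c p) (F a b r c q) ⊆ F a b r c '' segment ℝ p q := by
  rintro _ ⟨s, t, hs, ht, hst, rfl⟩
  exact ⟨s • p + t • q, ⟨s, t, hs, ht, hst, rfl⟩, F_combo_right hp hq hs ht hst⟩

/-! ### The invariant triangle -/

/-- A forward invariant triangle, bounded by the stable and the unstable line of the fixed point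
in `x < 0` and by the image of the part of the unstable line in `x ≥ 0`. -/
def trap (a b r c : ℝ) : Set (ℝ × ℝ) :=
  {z | -a ≤ (a - 1) * (z.2 + a * z.1) ∧ (1 - b) * (z.2 + b * z.1) ≤ b ∧
    r * c * ((1 - b) * z.1 - 1) ≤ (r + c + b) * (1 - b) * z.2}

lemma convex_trap : Convex ℝ (trap a b r c) := by
  rintro p ⟨h1, h2, h3⟩ q ⟨k1, k2, k3⟩ s t hs ht hst
  have e1 := add_le_add (mul_le_mul_of_nonneg_left h1 hs) (mul_le_mul_of_nonneg_left k1 ht)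
  have e2 := add_le_add (mul_le_mul_of_nonneg_left h2 hs) (mul_le_mul_of_nonneg_left k2 ht)
  have e3 := add_le_add (mul_le_mul_of_nonneg_left h3 hs) (mul_le_mul_of_nonneg_left k3 ht)
  obtain rfl : t = 1 - s := by linarith
  refine ⟨?_, ?_, ?_⟩ <;>
    simp only [Prod.fst_add, Prod.smul_fst, smul_eq_mul, Prod.snd_add, Prod.smul_snd] <;> nlinarith

lemma fst_le_of_mem_trap (h : Admissible a b r c) {z : ℝ × ℝ} (hz : z ∈ trap a b r c) :
    (1 - b) * z.1 ≤ 1 := by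
  obtain ⟨-, h2, h3⟩ := hz
  have hb := h.b_lt
  have hb0 := h.b_pos
  have hr := h.one_lt_r
  have hc := h.c_pos
  have e := mul_le_mul_of_nonneg_left h2 (show 0 ≤ r + c + b by linarith)
  have : 0 < r * c + b * (r + c + b) := by positivity
  nlinarith

/-- For `x ≤ 0` the bounds along the eigenlines of `Y` reproduce themselves, and the image lies in
`y ≥ 0`, above the third side. For `x ≥ 0` the second bound becomes the third. The first bound is
the delicate one: positivity of `phi` says that the image of the vertex `(1 / (1 - b), 0)` satisfies
it strictly. -/
lemma mapsTo_trap (h : Admissible a b r c) : MapsTo (F a b r c) (trap a b r c) (trap a b r c) := by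
  intro z hz
  have hx := fst_le_of_mem_trap h hz
  obtain ⟨h1, h2, h3⟩ := hz
  have hb := h.b_lt
  have hb0 := h.b_pos
  have ha := h.one_lt_a
  have hr := h.one_lt_r
  have hc := h.c_pos
  have hb1 : 0 < 1 - b := by linarith
  have hrc : 0 < r * c := by positivity
  rcases le_total z.1 0 with hz | hz
  · rw [F_left hz]
    have hab : 0 ≤ a * b * (-z.1) := by
      have : 0 ≤ -z.1 := by linarith
      positivity
    have e2 : (1 - b) * (-(a * b) * z.1 + b * ((a + b) * z.1 + z.2 + 1)) ≤ b := by
      nlinarith [mul_le_mul_of_nonneg_left h2 hb0.le]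
    refine ⟨?_, e2, ?_⟩ <;> dsimp only
    · nlinarith [mul_le_mul_of_nonneg_left h1 (show 0 ≤ a by linarith)]
    · have e3 : (1 - b) * ((a + b) * z.1 + z.2 + 1) ≤ 1 := by
        have : b * ((1 - b) * ((a + b) * z.1 + z.2 + 1)) ≤ b * 1 := by nlinarith
        exact le_of_mul_le_mul_left this hb0
      have e4 : 0 ≤ (r + c + b) * (1 - b) * (a * b * (-z.1)) := by positivity
      nlinarith
  · rw [F_right hz]
    have e3 : r * c * ((1 - b) * (-(r + c) * z.1 + z.2 + 1) - 1) ≤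
        (r + c + b) * (1 - b) * (-(r * c) * z.1) := by
      nlinarith [mul_le_mul_of_nonneg_left h2 hrc.le]
    have hy : 0 ≤ r * c * z.1 := by positivity
    refine ⟨?_, ?_, e3⟩ <;> dsimp only
    · have hphi := h.phi_pos
      -- Up to the constant `a`, the value of `y + a * x` at the image is `a * y - (r * c + a * (r +
      -- c)) * x`. By `k` it does not increase with `x` along the third side, so its least value is
      -- at the vertex `(1 / (1 - b), 0)`.
      have k : 0 ≤ (r * c + a * (r + c)) * (r + c + b) - a * (r * c) := by
        have : (r * c + a * (r + c)) * (r + c + b) - a * (r * c) =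
          r * c * (r + c + b) + a * (r * r + r * c + c * c + b * (r + c)) := by ring
        rw [this]; positivity
      have k1 := mul_nonneg k (show 0 ≤ 1 - (1 - b) * z.1 by linarith)
      have k2 := mul_le_mul_of_nonneg_left h3 (show 0 ≤ a by linarith)
      have k3 : 0 ≤ (r + c + b) * ((1 - b) * (a * z.2 - (r * c + a * (r + c)) * z.1) +
        (r * c + a * (r + c))) := by linarith
      have k4 := nonneg_of_mul_nonneg_right k3 (by positivity)
      have k5 := mul_nonneg k4 (show 0 ≤ a - 1 by linarith)
      have k6 : 0 ≤ (1 - b) * ((a - 1) * (a * z.2 - (r * c + a * (r + c)) * z.1) + a ^ 2) := by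
        linarith
      have k7 := nonneg_of_mul_nonneg_right k6 hb1
      linarith
    · have e4 : r * c * ((1 - b) * (-(r + c) * z.1 + z.2 + 1) - 1) ≤ 0 := by
        have : 0 ≤ (r + c + b) * (1 - b) * (r * c * z.1) := by positivity
        nlinarith
      have e5 : (1 - b) * (-(r + c) * z.1 + z.2 + 1) - 1 ≤ 0 := by
        by_contra hcon
        push Not at hcon
        nlinarith [mul_pos hrc hcon]
      nlinarith

/-- On the line `x = 0`, the invariant triangle lies to the left of the stable line of `X`. -/
lemma neg_lt_of_mem_trap (h : Admissible a b r c) {z : ℝ × ℝ} (hz : z ∈ trap a b r c)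
    (hz0 : z.1 = 0) : -r < (1 + r) * z.2 := by
  obtain ⟨-, -, h3⟩ := hz
  have hcb := h.c_add_b_lt
  have hb0 := h.b_pos
  have hr := h.one_lt_r
  have hc := h.c_pos
  rw [hz0] at h3
  have hb1 : 0 < 1 - b := by linarith
  -- The third side meets `x = 0` above the stable line exactly because `b + c < 1`.
  have k : 0 < r * (r + b) * (1 - b - c) := by
    have : 0 < 1 - b - c := by linarith
    positivity
  have : 0 < (r + c + b) * (1 - b) * ((1 + r) * z.2 + r) := by
    nlinarith [mul_le_mul_of_nonneg_left h3 (show 0 ≤ 1 + r by linarith)]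
  have := pos_of_mul_pos_right this (by positivity)
  linarith

/-- The bound is the first coordinate of `Y`, the vertex on both eigenlines. -/
lemma le_fst_of_mem_trap (h : Admissible a b r c) {z : ℝ × ℝ} (hz : z ∈ trap a b r c) :
    -(a / (a - 1) + b / (1 - b)) / (a - b) ≤ z.1 := by
  obtain ⟨h1, h2, -⟩ := hz
  have hb := h.b_lt
  have ha := h.one_lt_a
  have e1 : -(a / (a - 1)) ≤ z.2 + a * z.1 := by
    rw [← neg_div, div_le_iff₀ (by linarith)]; linarith
  have e2 : z.2 + b * z.1 ≤ b / (1 - b) := by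
    rw [le_div_iff₀ (by linarith)]; linarith
  rw [div_le_iff₀ (by linarith)]
  linarith

/-! ### Eigencoordinates at `X`, stable and unstable sets -/

/-- The first coordinate of the fixed point `X`. -/
noncomputable def x₀ (r c : ℝ) : ℝ := 1 / ((1 + r) * (1 + c))

/-- The point with coordinates `s`, `t` in the frame at `X` formed by the eigenvectors `(1, c)`,
with eigenvalue `-r`, and `(1, r)`, with eigenvalue `-c`. -/
noncomputable def P (r c s t : ℝ) : ℝ × ℝ :=
  (x₀ r c + s + t, -(r * c) * x₀ r c + c * s + r * t)

lemma x₀_eq (h : Admissible a b r c) : (1 + r) * (1 + c) * x₀ r c = 1 := by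
  have := h.one_lt_r
  have := h.c_pos
  unfold x₀
  field_simp

lemma x₀_pos (h : Admissible a b r c) : 0 < x₀ r c := by
  have := h.one_lt_r
  have := h.c_pos
  unfold x₀
  positivity

lemma P_zero_zero (h : Admissible a b r c) : P r c 0 0 = X (-(r + c)) (r * c) := by
  have := h.one_lt_r
  have := h.c_pos
  have e : r * c + 1 - -(r + c) = (1 + r) * (1 + c) := by ring
  simp only [P, X, x₀, e]
  ext <;> simp [div_eq_mul_inv]

lemma continuous_P : Continuous fun w : ℝ × ℝ => P r c w.1 w.2 := by
  unfold P; fun_prop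

lemma P_combo (s t s' t' u v : ℝ) (huv : u + v = 1) :
    u • P r c s t + v • P r c s' t' = P r c (u * s + v * s') (u * t + v * t') := by
  obtain rfl : v = 1 - u := by linarith
  ext <;> simp [P] <;> ring

/-- The unstable coordinate. -/
noncomputable def ξ (r c : ℝ) (z : ℝ × ℝ) : ℝ := (r * z.1 - z.2 - r * (1 + c) * x₀ r c) / (r - c)

/-- The stable coordinate. -/
noncomputable def η (r c : ℝ) (z : ℝ × ℝ) : ℝ := (z.2 - c * z.1 + c * (1 + r) * x₀ r c) / (r - c)

lemma P_ξ_η (hrc : c < r) (z : ℝ × ℝ) : P r c (ξ r c z) (η r c z) = z := by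
  have : r - c ≠ 0 := by linarith
  ext <;> simp only [P, ξ, η] <;> field_simp <;> ring

lemma ξ_P (hrc : c < r) (s t : ℝ) : ξ r c (P r c s t) = s := by
  have : r - c ≠ 0 := by linarith
  simp only [P, ξ]; field_simp; ring

lemma η_P (hrc : c < r) (s t : ℝ) : η r c (P r c s t) = t := by
  have : r - c ≠ 0 := by linarith
  simp only [P, η]; field_simp; ring

lemma continuous_ξ : Continuous (ξ r c) := by unfold ξ; fun_prop

lemma continuous_η : Continuous (η r c) := by unfold η; fun_prop

lemma Admissible.c_lt_r (h : Admissible a b r c) : c < r := by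
  linarith [h.c_lt, h.one_lt_r]

lemma F_P (h : Admissible a b r c) {s t : ℝ} (hst : 0 ≤ x₀ r c + s + t) :
    F a b r c (P r c s t) = P r c (-r * s) (-c * t) := by
  rw [F_right (by simpa [P] using hst)]
  have := x₀_eq h
  ext <;> simp only [P] <;> linarith

lemma iterate_F_P (h : Admissible a b r c) {s t : ℝ} (k : ℕ)
    (hst : ∀ j < k, 0 ≤ x₀ r c + (-r) ^ j * s + (-c) ^ j * t) :
    (F a b r c)^[k] (P r c s t) = P r c ((-r) ^ k * s) ((-c) ^ k * t) := by
  induction k with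
  | zero => simp
  | succ k ih =>
    rw [Function.iterate_succ_apply', ih fun j hj => hst j (by lia), F_P h (hst k (by lia))]
    congr 1 <;> ring

/-- The lower bound of `x` along an orbit on the stable line. -/
lemma le_neg_pow_mul (h : Admissible a b r c) {t m : ℝ} (h0 : m ≤ 0) (h1 : m ≤ t)
    (h2 : m ≤ -c * t) (j : ℕ) : m ≤ (-c) ^ j * t := by
  have hc := h.c_pos
  have hc1 := h.c_lt
  induction j using Nat.twoStepInduction with
  | zero => simpa using h1
  | one => simpa using h2
  | more j ih _ =>
    have e : (-c) ^ (j + 2) * t = c ^ 2 * ((-c) ^ j * t) := by ring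
    rw [e]
    nlinarith [mul_le_mul_of_nonneg_left ih (sq_nonneg c),
      mul_nonneg (show 0 ≤ 1 - c ^ 2 by nlinarith) (neg_nonneg.2 h0)]

lemma iterate_F_stable (h : Admissible a b r c) {t : ℝ} (h1 : 0 ≤ x₀ r c + t)
    (h2 : 0 ≤ x₀ r c - c * t) (k : ℕ) :
    (F a b r c)^[k] (P r c 0 t) = P r c 0 ((-c) ^ k * t) := by
  rw [iterate_F_P h k, mul_zero]
  intro j _
  have := le_neg_pow_mul h (m := -x₀ r c) (t := t) (by linarith [x₀_pos h]) (by linarith)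
    (by linarith) j
  linarith

lemma tendsto_neg_c_pow (h : Admissible a b r c) (t : ℝ) :
    Tendsto (fun k : ℕ => (-c) ^ k * t) atTop (𝓝 0) := by
  have : |(-c)| < 1 := by rw [abs_neg, abs_of_pos h.c_pos]; exact h.c_lt
  simpa using (tendsto_pow_atTop_nhds_zero_of_abs_lt_one this).mul_const t

lemma mem_Ws (h : Admissible a b r c) {t : ℝ} (h1 : 0 ≤ x₀ r c + t)
    (h2 : 0 ≤ x₀ r c - c * t) : P r c 0 t ∈ Ws (F a b r c) (X (-(r + c)) (r * c)) := by
  simp only [Ws, mem_ofPred_eq, iterate_F_stable h h1 h2, ← P_zero_zero h]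
  have := (continuous_P (r := r) (c := c)).tendsto (0, 0)
  exact this.comp (tendsto_const_nhds.prodMk_nhds (tendsto_neg_c_pow h t))

lemma mapsTo_Wu {g : ℝ × ℝ → ℝ × ℝ} {p : ℝ × ℝ} : MapsTo g (Wu g p) (Wu g p) := by
  rintro z ⟨u, rfl, h1, h2⟩
  refine ⟨fun n => Nat.casesOn n (g (u 0)) u, rfl, ?_, ?_⟩
  · rintro (_ | n)
    · rfl
    · exact h1 n
  · exact (tendsto_add_atTop_iff_nat 1).1 h2

lemma iterate_backward {g : ℝ × ℝ → ℝ × ℝ} {u : ℕ → ℝ × ℝ} (hu : ∀ n, g (u (n + 1)) = u n)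
    (m : ℕ) : g^[m] (u m) = u 0 := by
  induction m with
  | zero => rfl
  | succ m ih => rw [Function.iterate_succ_apply, hu, ih]

lemma image_iterate_Wu {g : ℝ × ℝ → ℝ × ℝ} {p : ℝ × ℝ} (n : ℕ) : g^[n] '' Wu g p = Wu g p := by
  refine (mapsTo_Wu.iterate n).image_subset.antisymm ?_
  rintro z ⟨u, rfl, h1, h2⟩
  refine ⟨u n, ⟨fun k => u (k + n), by simp, fun k => ?_, (tendsto_add_atTop_iff_nat n).2 h2⟩,
    iterate_backward h1 n⟩
  have := h1 (k + n)
  rwa [show k + n + 1 = k + 1 + n by ring] at this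

lemma tendsto_div_neg_r_pow (h : Admissible a b r c) (s : ℝ) :
    Tendsto (fun k : ℕ => s / (-r) ^ k) atTop (𝓝 0) := by
  have hr := h.one_lt_r
  have : |(-r)⁻¹| < 1 := by
    rw [abs_inv, abs_neg, abs_of_pos (by linarith)]; exact inv_lt_one_of_one_lt₀ hr
  simpa only [div_eq_mul_inv, inv_pow, mul_zero] using
    (tendsto_pow_atTop_nhds_zero_of_abs_lt_one this).const_mul s

/-- The part of the unstable line near `X` belongs to the unstable manifold. -/
lemma P_mem_Wu (h : Admissible a b r c) {s : ℝ} (hs : |s| ≤ r * x₀ r c) :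
    P r c s 0 ∈ Wu (F a b r c) (X (-(r + c)) (r * c)) := by
  have hr := h.one_lt_r
  refine ⟨fun n => P r c (s / (-r) ^ n) 0, by simp, fun n => ?_, ?_⟩
  · have e : |s / (-r) ^ (n + 1)| ≤ x₀ r c := by
      rw [abs_div, abs_pow, abs_neg, abs_of_pos (show 0 < r by linarith),
        div_le_iff₀ (by positivity)]
      have := one_le_pow₀ hr.le (n := n)
      have := x₀_pos h
      calc |s| ≤ 1 * (r * x₀ r c) := by linarith
        _ ≤ r ^ n * (r * x₀ r c) := by gcongr
        _ = _ := by ring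
    rw [F_P h (by linarith [neg_le_of_abs_le e])]
    congr 1
    · have : r ≠ 0 := by linarith
      have : (-r) ≠ 0 := neg_ne_zero.2 this
      rw [pow_succ]
      field_simp
    · simp
  · rw [← P_zero_zero h]
    have := (continuous_P (r := r) (c := c)).tendsto (0, 0)
    exact this.comp ((tendsto_div_neg_r_pow h s).prodMk_nhds tendsto_const_nhds)

/-- Backward orbits that converge to `X` end on the unstable line. -/
lemma exists_of_mem_Wu (h : Admissible a b r c) {z : ℝ × ℝ}
    (hz : z ∈ Wu (F a b r c) (X (-(r + c)) (r * c))) {ε : ℝ} (hε : 0 < ε) :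
    ∃ n s, |s| < ε ∧ (F a b r c)^[n] (P r c s 0) = z := by
  obtain ⟨u, rfl, h1, h2⟩ := hz
  rw [← P_zero_zero h] at h2
  have hcr := h.c_lt_r
  have hx : ∀ᶠ n in atTop, 0 < (u n).1 := by
    refine h2.eventually_mem ((isOpen_lt continuous_const continuous_fst).mem_nhds ?_)
    simpa [P] using x₀_pos h
  have hξ : Tendsto (fun n => ξ r c (u n)) atTop (𝓝 0) := by
    simpa only [ξ_P hcr, Function.comp_def] using
      (continuous_ξ (r := r) (c := c)).tendsto _ |>.comp h2
  have hη : Tendsto (fun n => η r c (u n)) atTop (𝓝 0) := by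
    simpa only [η_P hcr, Function.comp_def] using
      (continuous_η (r := r) (c := c)).tendsto _ |>.comp h2
  obtain ⟨N, hN⟩ := eventually_atTop.1 (hx.and
    (hξ.eventually_mem (Metric.ball_mem_nhds 0 hε)))
  -- Near `X` a backward step divides the stable coordinate by `-c`, so its modulus cannot decrease.
  -- Since it tends to `0`, it vanishes.
  have hstep : ∀ n ≥ N, |η r c (u n)| ≤ |η r c (u (n + 1))| := by
    intro n hn
    have h3 := F_P h (s := ξ r c (u (n + 1))) (t := η r c (u (n + 1))) (by
      have := (hN (n + 1) (by lia)).1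
      have e := congrArg Prod.fst (P_ξ_η hcr (u (n + 1)))
      simp only [P] at e
      rw [e]; exact this.le)
    rw [P_ξ_η hcr, h1] at h3
    rw [h3, η_P hcr, abs_mul, abs_neg, abs_of_pos h.c_pos]
    nlinarith [h.c_lt, abs_nonneg (η r c (u (n + 1)))]
  have hmono : ∀ k, |η r c (u N)| ≤ |η r c (u (N + k))| := by
    intro k
    induction k with
    | zero => rfl
    | succ k ih => exact ih.trans (hstep (N + k) (by lia))
  have hz : η r c (u N) = 0 := by
    have : Tendsto (fun k => |η r c (u (N + k))|) atTop (𝓝 0) := by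
      have := hη.abs.comp (tendsto_add_atTop_nat N)
      simpa [Function.comp_def, add_comm] using this
    exact abs_nonpos_iff.1 (ge_of_tendsto' this hmono)
  refine ⟨N, ξ r c (u N), by simpa using (hN N le_rfl).2, ?_⟩
  rw [← hz, P_ξ_η hcr]
  exact iterate_backward h1 N

/-- In the invariant triangle, points on the stable line with `x ≥ 0` remain in `x > 0`. -/
lemma stable_of_mem_trap (h : Admissible a b r c) {t : ℝ} (ht : P r c 0 t ∈ trap a b r c)
    (hx : 0 ≤ x₀ r c + t) : 0 < x₀ r c + t ∧ 0 < x₀ r c - c * t := by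
  have e := x₀_eq h
  have hr := h.one_lt_r
  have hc := h.c_pos
  have hb := h.b_pos
  have hcb := h.c_add_b_lt
  constructor
  · refine lt_of_le_of_ne hx fun h0 => ?_
    have := neg_lt_of_mem_trap h ht (by simp [P, h0.symm])
    simp only [P] at this
    have e1 : t = - x₀ r c := by linarith
    rw [e1] at this
    nlinarith
  · have h2 := ht.2.1
    simp only [P] at h2
    have e2 : (1 - b) * ((r + b) * ((1 + r) * (x₀ r c + t)) - r) ≤ b * (1 + r) := by
      have k := congrArg (fun w => r * (1 - b) * w) e
      have k' := mul_le_mul_of_nonneg_left h2 (show 0 ≤ 1 + r by linarith)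
      linarith
    -- Since `(1 + r) * (1 + c) * x₀ = 1`, this is the goal multiplied by `1 + r`.
    have e3 : c * ((1 + r) * (x₀ r c + t)) < 1 := by
      have k1 : (1 - b) * ((r + b) * ((1 + r) * (x₀ r c + t))) ≤ r + b := by nlinarith
      have k2 : (1 - b) * ((1 + r) * (x₀ r c + t)) ≤ 1 := by
        have : (r + b) * ((1 - b) * ((1 + r) * (x₀ r c + t))) ≤ (r + b) * 1 := by linarith
        exact le_of_mul_le_mul_left this (by positivity)
      rcases hx.eq_or_lt with h0 | h0
      · rw [← h0]; simp
      · have : 0 < (1 - b - c) * ((1 + r) * (x₀ r c + t)) := by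
          have : 0 < 1 - b - c := by linarith
          positivity
        linarith
    have : 0 < (1 + r) * (x₀ r c - c * t) := by nlinarith
    exact pos_of_mul_pos_right this (by positivity)

/-! ### The point `T` and the homoclinic point -/

/-- The intersection of the unstable line with `y = 0`. -/
noncomputable def Tpt (r c : ℝ) : ℝ × ℝ := P r c (r * x₀ r c) 0

lemma Tpt_eq : Tpt r c = ((1 + r) * x₀ r c, 0) := by
  ext <;> simp only [Tpt, P] <;> ring

lemma Tpt_mem_trap (h : Admissible a b r c) : Tpt r c ∈ trap a b r c := by
  have e := x₀_eq h
  have hx := x₀_pos h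
  have hr := h.one_lt_r
  have ha := h.one_lt_a
  have hc := h.c_pos
  have hb := h.b_pos
  have hb1 : 0 < 1 - b := by linarith [h.b_lt]
  have hrc : 0 < r * c := by positivity
  have hT : 0 < (1 + r) * x₀ r c := by positivity
  have hT1 : (1 + r) * x₀ r c < 1 := by nlinarith
  have hT2 : (1 - b) * ((1 + r) * x₀ r c) < 1 := by nlinarith
  rw [Tpt_eq]
  refine ⟨?_, ?_, ?_⟩ <;> dsimp only
  · have : 0 < (a - 1) * (a * ((1 + r) * x₀ r c)) := by
      have : 0 < a - 1 := by linarith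
      positivity
    linarith
  · nlinarith
  · nlinarith

lemma X_mem_trap (h : Admissible a b r c) : P r c 0 0 ∈ trap a b r c := by
  have e := x₀_eq h
  have hx := x₀_pos h
  have hr := h.one_lt_r
  have ha := h.one_lt_a
  have hc := h.c_pos
  have hb := h.b_pos
  have hrc1 := h.rc_lt
  have hb1 : 0 < 1 - b := by linarith [h.b_lt]
  have hrc : 0 < r * c := by positivity
  have hrx : 0 < r * c * x₀ r c := by positivity
  have hx1 : x₀ r c < 1 := by nlinarith [mul_pos hc hx, mul_pos (show 0 < r by linarith) hx]
  refine ⟨?_, ?_, ?_⟩ <;> simp only [P]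
  · have : 0 < (a - 1) * ((a - r * c) * x₀ r c) := by
      have : 0 < a - 1 := by linarith
      have : 0 < a - r * c := by linarith
      positivity
    nlinarith
  · have : (1 - b) * (b * x₀ r c) ≤ 1 * (b * 1) := by gcongr; linarith
    nlinarith [mul_pos hb1 hrx]
  · have : 0 < (b * r + b * c + b ^ 2 + r * c) * x₀ r c := by positivity
    have k : 0 < 1 - (1 - b) * ((1 + r + c + b) * x₀ r c) := by linarith
    nlinarith [mul_pos hrc k]

lemma F_Tpt (h : Admissible a b r c) : F a b r c (Tpt r c) = P r c (-(r ^ 2 * x₀ r c)) 0 := by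
  have hr := h.one_lt_r
  have hx := x₀_pos h
  rw [Tpt, F_P h (by have := mul_pos (show 0 < r by linarith) hx; linarith)]
  congr 1 <;> ring

lemma F_Tpt_fst (h : Admissible a b r c) : (F a b r c (Tpt r c)).1 ≤ 0 := by
  have hr := h.one_lt_r
  have hx := x₀_pos h
  rw [F_Tpt h]
  simp only [P]
  nlinarith [mul_pos (show 0 < r ^ 2 - 1 by nlinarith) hx]

lemma F_F_Tpt (h : Admissible a b r c) : F a b r c (F a b r c (Tpt r c)) =
    ((1 - (a + b) * (r - 1) * (1 + r) * x₀ r c - r * c * (1 + r) * x₀ r c),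
      a * b * (r - 1) * (1 + r) * x₀ r c) := by
  rw [F_left (F_Tpt_fst h), F_Tpt h]
  ext <;> simp only [P] <;> ring

/-- The second image of `T` lies to the left of the stable line. -/
lemma ξ_F_F_Tpt (h : Admissible a b r c) : ξ r c (F a b r c (F a b r c (Tpt r c))) < 0 := by
  have e := x₀_eq h
  have hx := x₀_pos h
  have hr := h.one_lt_r
  have ha := h.one_lt_a
  have hc := h.c_pos
  have hb := h.b_pos
  have hcr := h.c_lt_r
  have k := mul_pos (show 0 < r by linarith) (sub_pos.2 h.r_lt)
  have k1 : 0 < (r * b + a * b) * (r ^ 2 - 1) + r ^ 3 * c := by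
    have : 0 < r ^ 2 - 1 := by nlinarith
    positivity
  have k2 := mul_pos hx (add_pos k k1)
  rw [F_F_Tpt h, ξ]
  refine div_neg_of_neg_of_pos ?_ (by linarith)
  dsimp only
  nlinarith

/-- The point `P (-x₀) 0` of the unstable line on `x = 0` is mapped to `T`. The segment from it to
the image of `T` lies in `x ≤ 0`, where the map is affine, and is itself an image of unstable points
near `X`. -/
lemma segment_subset_Wu (h : Admissible a b r c) :
    segment ℝ (Tpt r c) (F a b r c (F a b r c (Tpt r c))) ⊆
      Wu (F a b r c) (X (-(r + c)) (r * c)) := by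
  have hr := h.one_lt_r
  have hx := x₀_pos h
  have hD : F a b r c (P r c (-x₀ r c) 0) = Tpt r c := by
    rw [F_P h (by linarith), Tpt]; congr 1 <;> ring
  have hD0 : (P r c (-x₀ r c) 0).1 ≤ 0 := by simp [P]
  refine fun z hz => ?_
  rw [← hD] at hz
  nth_rewrite 2 [hD] at hz
  obtain ⟨w, hw, rfl⟩ := segment_subset_image_left hD0 (F_Tpt_fst h) hz
  refine mapsTo_Wu ?_
  rw [F_Tpt h] at hw
  obtain ⟨s, t, hs, ht, hst, rfl⟩ := hw
  rw [P_combo _ _ _ _ _ _ hst]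
  obtain rfl : t = 1 - s := by linarith
  have hpos : 0 ≤ (s + (1 - s) * r ^ 2) * x₀ r c / r := by positivity
  have : P r c (s * -x₀ r c + (1 - s) * -(r ^ 2 * x₀ r c)) (s * 0 + (1 - s) * 0) =
      F a b r c (P r c ((s + (1 - s) * r ^ 2) * x₀ r c / r) 0) := by
    rw [F_P h (by linarith)]
    congr 1
    · field_simp
      ring
    · ring
  rw [this]
  refine mapsTo_Wu (P_mem_Wu h ?_)
  rw [abs_of_nonneg hpos, div_le_iff₀ (by linarith)]
  have : s + (1 - s) * r ^ 2 ≤ r ^ 2 := by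
    linarith [mul_nonneg hs (show 0 ≤ r ^ 2 - 1 by nlinarith)]
  nlinarith

/-- The homoclinic point at which the segment from `T` to its second image crosses the stable
line. -/
lemma exists_crossing (h : Admissible a b r c) : ∃ u v t : ℝ, 0 < u ∧ 0 < v ∧ u + v = 1 ∧
    u • Tpt r c + v • F a b r c (F a b r c (Tpt r c)) = P r c 0 t ∧
    P r c 0 t ∈ trap a b r c ∧ 0 < x₀ r c + t ∧ 0 < x₀ r c - c * t ∧ 0 < t := by
  have hr := h.one_lt_r
  have hb := h.b_pos
  have ha := h.one_lt_a
  have hc := h.c_pos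
  have hx := x₀_pos h
  have hq := ξ_F_F_Tpt h
  have hcr := h.c_lt_r
  set Q := F a b r c (F a b r c (Tpt r c)) with hQ
  have hQ2 : 0 ≤ Q.2 := by
    rw [hQ, F_F_Tpt h]
    have : 0 < r - 1 := by linarith
    positivity
  have hrx : 0 < r * x₀ r c := by positivity
  have hd : 0 < r * x₀ r c - ξ r c Q := by linarith
  have hQt : Q ∈ trap a b r c := mapsTo_trap h (mapsTo_trap h (Tpt_mem_trap h))
  -- These weights make the unstable coordinate of the combination vanish.
  set u := -ξ r c Q / (r * x₀ r c - ξ r c Q) with hu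
  set v := r * x₀ r c / (r * x₀ r c - ξ r c Q) with hv
  have hu0 : 0 < u := div_pos (by linarith) hd
  have hv0 : 0 < v := div_pos hrx hd
  have huv : u + v = 1 := by rw [hu, hv]; field_simp; ring
  have e : u • Tpt r c + v • Q = P r c 0 (v * η r c Q) := by
    nth_rewrite 1 [← P_ξ_η hcr Q]
    rw [Tpt, P_combo _ _ _ _ _ _ huv]
    congr 1
    · rw [hu, hv]; field_simp; ring
    · ring
  have ht : P r c 0 (v * η r c Q) ∈ trap a b r c :=
    e ▸ convex_trap (Tpt_mem_trap h) hQt hu0.le hv0.le huv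
  -- On the stable line, `y ≥ 0` forces `t ≥ c * x₀`.
  have ht0 : 0 < v * η r c Q := by
    have k := congrArg Prod.snd e
    simp only [P, Tpt_eq, Prod.snd_add, Prod.smul_snd, smul_eq_mul] at k
    have : 0 ≤ v * Q.2 := by positivity
    have : 0 < r * (v * η r c Q) := by nlinarith [mul_pos (mul_pos (show 0 < r by linarith) hc) hx]
    exact pos_of_mul_pos_right this (by linarith)
  obtain ⟨k1, k2⟩ := stable_of_mem_trap h ht (by linarith)
  exact ⟨u, v, _, hu0, hv0, huv, e, ht, k1, k2, ht0⟩

lemma mem_Es_iff (h : Admissible a b r c) {z : ℝ × ℝ} :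
    A (-(r + c)) (r * c) (z - P r c 0 0) = (-c) • (z - P r c 0 0) ↔ ξ r c z = 0 := by
  have hc := h.c_pos
  have hcr := h.c_lt_r
  obtain ⟨s, t, rfl⟩ : ∃ s t, z = P r c s t := ⟨_, _, (P_ξ_η hcr z).symm⟩
  rw [ξ_P hcr]
  constructor
  · intro k
    have := congrArg Prod.fst k
    simp only [A, P, Prod.fst_sub, Prod.snd_sub, Prod.smul_fst, smul_eq_mul] at this
    have : (r - c) * s = 0 := by linarith
    exact (mul_eq_zero.1 this).resolve_left (by linarith)
  · rintro rfl
    ext <;> simp only [A, P, Prod.fst_sub, Prod.snd_sub, Prod.smul_fst, Prod.smul_snd,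
      smul_eq_mul] <;> ring

lemma mem_Eu_iff (h : Admissible a b r c) {z : ℝ × ℝ} :
    A (-(r + c)) (r * c) (z - P r c 0 0) = (-r) • (z - P r c 0 0) ↔ η r c z = 0 := by
  have hc := h.c_pos
  have hcr := h.c_lt_r
  obtain ⟨s, t, rfl⟩ : ∃ s t, z = P r c s t := ⟨_, _, (P_ξ_η hcr z).symm⟩
  rw [η_P hcr]
  constructor
  · intro k
    have := congrArg Prod.fst k
    simp only [A, P, Prod.fst_sub, Prod.snd_sub, Prod.smul_fst, smul_eq_mul] at this
    have : (r - c) * t = 0 := by linarith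
    exact (mul_eq_zero.1 this).resolve_left (by linarith)
  · rintro rfl
    ext <;> simp only [A, P, Prod.fst_sub, Prod.snd_sub, Prod.smul_fst, Prod.smul_snd,
      smul_eq_mul] <;> ring

lemma Admissible.lamRs_eq (h : Admissible a b r c) : lamRs (-(r + c)) (r * c) = -c := by
  have e : (-(r + c)) ^ 2 - 4 * (r * c) = (r - c) ^ 2 := by ring
  rw [lamRs, e, Real.sqrt_sq (by linarith [h.c_lt_r])]
  ring

lemma Admissible.lamRu_eq (h : Admissible a b r c) : lamRu (-(r + c)) (r * c) = -r := by
  have e : (-(r + c)) ^ 2 - 4 * (r * c) = (r - c) ^ 2 := by ring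
  rw [lamRu, e, Real.sqrt_sq (by linarith [h.c_lt_r])]
  ring

lemma Es_eq (h : Admissible a b r c) : Es (-(r + c)) (r * c) = {z | ξ r c z = 0} := by
  ext z
  rw [Es, h.lamRs_eq, ← P_zero_zero h]
  exact mem_Es_iff h

lemma Eu_eq (h : Admissible a b r c) : Eu (-(r + c)) (r * c) = {z | η r c z = 0} := by
  ext z
  rw [Eu, h.lamRu_eq, ← P_zero_zero h]
  exact mem_Eu_iff h

lemma Eu_inter (h : Admissible a b r c) :
    Eu (-(r + c)) (r * c) ∩ {z | z.2 = 0} = {Tpt r c} := by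
  have hc := h.c_pos
  have hcr := h.c_lt_r
  rw [Eu_eq h]
  ext z
  simp only [mem_inter_iff, mem_ofPred_eq, mem_singleton_iff]
  constructor
  · rintro ⟨h1, h2⟩
    rw [← P_ξ_η hcr z, h1] at h2 ⊢
    simp only [P] at h2
    have : c * (ξ r c z - r * x₀ r c) = 0 := by linarith
    rw [Tpt, sub_eq_zero.1 ((mul_eq_zero.1 this).resolve_left hc.ne')]
  · rintro rfl
    exact ⟨by rw [Tpt, η_P hcr], by rw [Tpt_eq]⟩

lemma liesLeftOf_Es (h : Admissible a b r c) {q : ℝ × ℝ} (hq : ξ r c q < 0) :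
    LiesLeftOf q (Es (-(r + c)) (r * c)) := by
  have hr : 0 < r := by linarith [h.one_lt_r]
  have hcr := h.c_lt_r
  have hcr' : 0 < r - c := by linarith
  rw [Es_eq h]
  refine ⟨⟨((q.2 + r * (1 + c) * x₀ r c) / r, q.2), ?_, rfl⟩, fun p hp hpq => ?_⟩
  · simp only [mem_ofPred_eq, ξ]
    field_simp
    ring
  · simp only [mem_ofPred_eq, ξ, div_eq_zero_iff, hcr'.ne', or_false] at hp
    rw [ξ, div_neg_iff] at hq
    have := hq.resolve_left (fun k => by linarith [k.2])
    nlinarith [this.1]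

lemma segment_inter_Es (h : Admissible a b r c) {u v t : ℝ} (hu : 0 < u) (hv : 0 < v)
    (huv : u + v = 1)
    (e : u • Tpt r c + v • F a b r c (F a b r c (Tpt r c)) = P r c 0 t) :
    segment ℝ (Tpt r c) (F a b r c (F a b r c (Tpt r c))) ∩ Es (-(r + c)) (r * c) =
      {P r c 0 t} := by
  have hcr := h.c_lt_r
  have hr := h.one_lt_r
  have hrx : 0 < r * x₀ r c := mul_pos (by linarith) (x₀_pos h)
  have hQ := ξ_F_F_Tpt h
  set Q := F a b r c (F a b r c (Tpt r c))
  have hξ : ∀ s t : ℝ, s + t = 1 → ξ r c (s • Tpt r c + t • Q) = s * (r * x₀ r c) + t * ξ r c Q := by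
    intro s t hst
    nth_rewrite 1 [← P_ξ_η hcr Q]
    rw [Tpt, P_combo _ _ _ _ _ _ hst, ξ_P hcr]
  rw [Es_eq h]
  ext z
  simp only [mem_inter_iff, mem_ofPred_eq, mem_singleton_iff]
  constructor
  · rintro ⟨⟨s, t', hs, ht, hst, rfl⟩, h2⟩
    rw [hξ _ _ hst] at h2
    have h3 := hξ u v huv
    rw [e, ξ_P hcr] at h3
    obtain rfl : t' = 1 - s := by linarith
    obtain rfl : v = 1 - u := by linarith
    have : (s - u) * (r * x₀ r c - ξ r c Q) = 0 := by linarith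
    obtain rfl : s = u := sub_eq_zero.1 ((mul_eq_zero.1 this).resolve_right (by linarith))
    exact e
  · rintro rfl
    exact ⟨⟨u, v, hu.le, hv.le, huv, e⟩, ξ_P hcr _ _⟩

lemma isTransverseHomoclinic (h : Admissible a b r c) {u v t : ℝ} (hu : 0 < u) (hv : 0 < v)
    (huv : u + v = 1)
    (e : u • Tpt r c + v • F a b r c (F a b r c (Tpt r c)) = P r c 0 t)
    (h1 : 0 < x₀ r c + t) (h2 : 0 < x₀ r c - c * t) (ht : 0 < t) :
    IsTransverseHomoclinic (F a b r c) (X (-(r + c)) (r * c)) (P r c 0 t) := by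
  have hcr := h.c_lt_r
  have hc := h.c_pos
  have hc1 := h.c_lt
  have hr := h.one_lt_r
  have hrx : 0 < r * x₀ r c := mul_pos (by linarith) (x₀_pos h)
  have hQ := ξ_F_F_Tpt h
  have hseg := segment_subset_Wu h
  set Q := F a b r c (F a b r c (Tpt r c))
  refine ⟨fun k => ?_, Q - Tpt r c, (1, r), ?_, min (min u v) (min (x₀ r c + t) (x₀ r c - c * t)),
    by positivity, fun s hs => ?_⟩
  · rw [← P_zero_zero h] at k
    have := congrArg (η r c) k
    rw [η_P hcr, η_P hcr] at this
    exact ht.ne' this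
  · rw [LinearIndependent.pair_iff]
    intro x y hxy
    have hT : ξ r c (Tpt r c) = r * x₀ r c := by rw [Tpt, ξ_P hcr]
    have k1 := congrArg Prod.fst hxy
    have k2 := congrArg Prod.snd hxy
    simp only [Prod.fst_add, Prod.snd_add, Prod.smul_fst, Prod.smul_snd, smul_eq_mul,
      Prod.fst_sub, Prod.snd_sub, Prod.fst_zero, Prod.snd_zero] at k1 k2
    -- The direction `(1, r)` does not change `ξ`, while `ξ` differs at the ends of the segment.
    have k3 : x * (ξ r c Q - ξ r c (Tpt r c)) = 0 := by
      simp only [ξ]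
      rw [← sub_div, mul_div_assoc', div_eq_zero_iff]
      left
      linear_combination r * k1 - k2
    have hx : x = 0 := (mul_eq_zero.1 k3).resolve_right (by linarith)
    subst hx
    exact ⟨rfl, by linarith⟩
  · simp only [lt_min_iff, abs_lt] at hs
    obtain ⟨⟨⟨s1, s2⟩, s3, s4⟩, ⟨s5, s6⟩, s7, s8⟩ := hs
    constructor
    · refine hseg ⟨u - s, v + s, by linarith, by linarith, by linarith, ?_⟩
      rw [← e]
      module
    · have : P r c 0 t + s • ((1, r) : ℝ × ℝ) = P r c 0 (t + s) := by
        ext <;> simp [P] <;> ring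
      rw [this]
      refine mem_Ws h (by linarith) ?_
      nlinarith

/-! ### Expansion of cone segments -/

/-- `p` and `q` lie in the invariant triangle, and the segment from `p` to `q` points to the right,
in a direction of the invariant expanding cone of slopes in `[-b, c]`. -/
structure ConeSeg (a b r c : ℝ) (p q : ℝ × ℝ) : Prop where
  left_mem : p ∈ trap a b r c
  right_mem : q ∈ trap a b r c
  lt : p.1 < q.1
  le_slope : -b * (q.1 - p.1) ≤ q.2 - p.2
  slope_le : q.2 - p.2 ≤ c * (q.1 - p.1)

namespace ConeSeg

variable {p q : ℝ × ℝ}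

/-- The left matrix sends `(1, m)` to `(a + b + m, -a * b)`. If `m ≥ -b`, the first entry is at
least `a`, so the new slope is in `[-b, 0]`. -/
lemma image_left (h : Admissible a b r c) (H : ConeSeg a b r c p q) (hq : q.1 ≤ 0) :
    ConeSeg a b r c (F a b r c p) (F a b r c q) ∧
      a * (q.1 - p.1) ≤ (F a b r c q).1 - (F a b r c p).1 := by
  have ha := h.one_lt_a
  have hb := h.b_pos
  have hc := h.c_pos
  have hlt := sub_pos.2 H.lt
  have h1 := H.le_slope
  have hab : 0 < a * (q.1 - p.1) := by positivity
  have hab' := mul_pos hb hab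
  have key : a * (q.1 - p.1) ≤ (F a b r c q).1 - (F a b r c p).1 := by
    rw [F_left hq, F_left (H.lt.le.trans hq)]
    dsimp only
    linarith
  have e : (F a b r c q).2 - (F a b r c p).2 = -(b * (a * (q.1 - p.1))) := by
    rw [F_left hq, F_left (H.lt.le.trans hq)]; ring
  refine ⟨⟨mapsTo_trap h H.left_mem, mapsTo_trap h H.right_mem, by linarith, ?_, ?_⟩, key⟩ <;>
    rw [e] <;> nlinarith

/-- The right matrix sends `(1, m)` to `(-(r + c) + m, -r * c)`. If `m ≤ c`, the first entry is at
most `-r`: the ends swap and the new slope is in `[0, c]`. -/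
lemma image_right (h : Admissible a b r c) (H : ConeSeg a b r c p q) (hp : 0 ≤ p.1) :
    ConeSeg a b r c (F a b r c q) (F a b r c p) ∧
      r * (q.1 - p.1) ≤ (F a b r c p).1 - (F a b r c q).1 := by
  have hr := h.one_lt_r
  have hb := h.b_pos
  have hc := h.c_pos
  have hlt := sub_pos.2 H.lt
  have h1 := H.slope_le
  have hq := hp.trans H.lt.le
  have hrp : 0 < r * (q.1 - p.1) := by positivity
  have hrc' := mul_pos hc hrp
  have key : r * (q.1 - p.1) ≤ (F a b r c p).1 - (F a b r c q).1 := by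
    rw [F_right hq, F_right hp]
    dsimp only
    linarith
  have e : (F a b r c p).2 - (F a b r c q).2 = c * (r * (q.1 - p.1)) := by
    rw [F_right hq, F_right hp]; ring
  refine ⟨⟨mapsTo_trap h H.right_mem, mapsTo_trap h H.left_mem, by linarith, ?_, ?_⟩, key⟩ <;>
    rw [e] <;> nlinarith

lemma exists_zero (H : ConeSeg a b r c p q) (hp : p.1 < 0) (hq : 0 < q.1) :
    ∃ w ∈ segment ℝ p q, w.1 = 0 ∧ ConeSeg a b r c p w ∧ ConeSeg a b r c w q := by
  have hd : 0 < q.1 - p.1 := by linarith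
  set s := q.1 / (q.1 - p.1) with hs
  set t := -p.1 / (q.1 - p.1) with ht
  have hs0 : 0 < s := div_pos hq hd
  have ht0 : 0 < t := div_pos (by linarith) hd
  have hst : s + t = 1 := by rw [hs, ht]; field_simp; ring
  have e : (s • p + t • q).1 = 0 := by
    simp only [Prod.fst_add, Prod.smul_fst, smul_eq_mul, hs, ht]; field_simp; ring
  have e2 : (s • p + t • q).2 = s * p.2 + t * q.2 := by simp
  have hw : s • p + t • q ∈ trap a b r c := convex_trap H.left_mem H.right_mem hs0.le ht0.le hst
  have e3 : t * (q.1 - p.1) = - p.1 := by rw [ht]; field_simp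
  have e4 : s * (q.1 - p.1) = q.1 := by rw [hs]; field_simp
  have l1 := mul_le_mul_of_nonneg_left H.le_slope ht0.le
  have l2 := mul_le_mul_of_nonneg_left H.slope_le ht0.le
  have l3 := mul_le_mul_of_nonneg_left H.le_slope hs0.le
  have l4 := mul_le_mul_of_nonneg_left H.slope_le hs0.le
  refine ⟨_, ⟨s, t, hs0.le, ht0.le, hst, rfl⟩, e, ⟨H.left_mem, hw, by rwa [e], ?_, ?_⟩,
    ⟨hw, H.right_mem, by rwa [e], ?_, ?_⟩⟩ <;> rw [e, e2]
  · rw [show s = 1 - t by linarith]; linear_combination l1 + b * e3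
  · rw [show s = 1 - t by linarith]; linear_combination l2 + c * e3
  · rw [show t = 1 - s by linarith]; linear_combination l3 + b * e4
  · rw [show t = 1 - s by linarith]; linear_combination l4 + c * e4

end ConeSeg

/-- The segment from `p` to `q` is contained in `x ≥ 0` and crosses the stable line of `X`. -/
structure Crossing (a b r c : ℝ) (p q : ℝ × ℝ) : Prop where
  left_mem : p ∈ trap a b r c
  right_mem : q ∈ trap a b r c
  left_nonneg : 0 ≤ p.1
  right_nonneg : 0 ≤ q.1
  left_neg : ξ r c p < 0
  right_pos : 0 < ξ r c q

/-- The stable line meets the axes at `(0, -r / (1 + r))` and `(1 / (1 + r), 0)`, and the first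
point is mapped to the second. So the bound on `x = 0` that puts `p` to the left of the line puts
`w'` to the right. -/
lemma crossing_of_cut (h : Admissible a b r c) {p w w' : ℝ × ℝ}
    (hp : p ∈ trap a b r c) (hp0 : p.1 = 0) (hw : w ∈ trap a b r c) (hw0 : w.1 = 0)
    (hw' : w' = F a b r c w) : Crossing a b r c p w' := by
  have e := x₀_eq h
  have hr := h.one_lt_r
  have hcr : 0 < r - c := by linarith [h.c_lt_r]
  have h1 := neg_lt_of_mem_trap h hp hp0
  have h2 := neg_lt_of_mem_trap h hw hw0
  have e1 : w' = (w.2 + 1, 0) := by rw [hw', F_left hw0.le, hw0]; ext <;> simp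
  refine ⟨hp, hw' ▸ mapsTo_trap h hw, hp0.ge, ?_, ?_, ?_⟩
  · rw [e1]
    dsimp only
    by_contra hcon
    nlinarith
  · rw [ξ, hp0]
    refine div_neg_of_neg_of_pos ?_ hcr
    by_contra hcon
    nlinarith
  · rw [ξ, e1]
    refine div_pos ?_ hcr
    dsimp only
    have : 0 < (1 + r) * (r * (w.2 + 1) - 0 - r * (1 + c) * x₀ r c) := by nlinarith
    exact pos_of_mul_pos_right this (by linarith)

lemma iterate_subset {g : ℝ × ℝ → ℝ × ℝ} {U V S : Set (ℝ × ℝ)} {n : ℕ} (h1 : U ⊆ g '' V)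
    (h2 : V ⊆ g^[n] '' S) : U ⊆ g^[n + 1] '' S := by
  rw [Function.iterate_succ', image_comp]
  exact h1.trans (image_mono h2)

/-- A cone segment that does not cross `x = 0` is mapped to a longer one. -/
lemma ConeSeg.exists_image (h : Admissible a b r c) {p q : ℝ × ℝ} (H : ConeSeg a b r c p q)
    {l : ℝ} (hla : l ≤ a) (hlr : l ≤ r) (hpq : q.1 ≤ 0 ∨ 0 ≤ p.1) :
    ∃ p' q', ConeSeg a b r c p' q' ∧ segment ℝ p' q' ⊆ F a b r c '' segment ℝ p q ∧
      l * (q.1 - p.1) ≤ q'.1 - p'.1 := by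
  have hd := sub_pos.2 H.lt
  rcases hpq with h0 | h0
  · obtain ⟨h1, h2⟩ := H.image_left h h0
    exact ⟨_, _, h1, segment_subset_image_left (H.lt.le.trans h0) h0, by nlinarith⟩
  · obtain ⟨h1, h2⟩ := H.image_right h h0
    refine ⟨_, _, h1, ?_, by nlinarith⟩
    rw [segment_symm ℝ p q]
    exact segment_subset_image_right (h0.trans H.lt.le) h0

/-- A cone segment with an end on the image of `x = 0` crosses the stable line, or it has a longer
image. -/
lemma ConeSeg.grow_of_cut (h : Admissible a b r c) {p q w : ℝ × ℝ} (H : ConeSeg a b r c p q)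
    {l : ℝ} (hla : l ≤ a) (hlr : l ≤ r) (hw : w ∈ trap a b r c) (hw0 : w.1 = 0)
    (hpq : p = F a b r c w ∨ q = F a b r c w) :
    (∃ p' q', Crossing a b r c p' q' ∧ segment ℝ p' q' ⊆ segment ℝ p q) ∨
      ∃ p' q', ConeSeg a b r c p' q' ∧ segment ℝ p' q' ⊆ F a b r c '' segment ℝ p q ∧
        l * (q.1 - p.1) ≤ q'.1 - p'.1 := by
  by_cases h0 : q.1 ≤ 0 ∨ 0 ≤ p.1
  · exact Or.inr (H.exists_image h hla hlr h0)
  · push Not at h0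
    obtain ⟨v, hv, hv0, h1, h2⟩ := H.exists_zero h0.2 h0.1
    left
    rcases hpq with h3 | h3
    · exact ⟨v, p, crossing_of_cut h h1.right_mem hv0 hw hw0 h3,
        (convex_segment p q).segment_subset hv (left_mem_segment ℝ p q)⟩
    · exact ⟨v, q, crossing_of_cut h h1.right_mem hv0 hw hw0 h3,
        (convex_segment p q).segment_subset hv (right_mem_segment ℝ p q)⟩

/-- Some iterate of a cone segment crosses the stable line, or is longer by a definite factor. -/
lemma ConeSeg.grow (h : Admissible a b r c) {p q : ℝ × ℝ} (H : ConeSeg a b r c p q)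
    {l k : ℝ} (hl : 0 < l) (hla : l ≤ a) (hlr : l ≤ r) (hkl : k ≤ l) (hk : 2 * k ≤ l ^ 2) :
    (∃ n p' q', Crossing a b r c p' q' ∧ segment ℝ p' q' ⊆ (F a b r c)^[n] '' segment ℝ p q) ∨
      ∃ n p' q', ConeSeg a b r c p' q' ∧ segment ℝ p' q' ⊆ (F a b r c)^[n] '' segment ℝ p q ∧
        k * (q.1 - p.1) ≤ q'.1 - p'.1 := by
  have hd := sub_pos.2 H.lt
  by_cases h0 : q.1 ≤ 0 ∨ 0 ≤ p.1
  · obtain ⟨p', q', h1, h2, h3⟩ := H.exists_image h hla hlr h0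
    exact Or.inr ⟨1, p', q', h1, h2, by nlinarith⟩
  push Not at h0
  obtain ⟨w, hw, hw0, h1, h2⟩ := H.exists_zero h0.2 h0.1
  -- The longer of the two pieces is kept: the cut costs a factor of at most `2`, but leaves an end
  -- at the image of `w`.
  have key : ∃ p₁ q₁, ConeSeg a b r c p₁ q₁ ∧ segment ℝ p₁ q₁ ⊆ F a b r c '' segment ℝ p q ∧
      l * (q.1 - p.1) ≤ 2 * (q₁.1 - p₁.1) ∧ (p₁ = F a b r c w ∨ q₁ = F a b r c w) := by
    rcases le_total (q.1 - p.1) (2 * (w.1 - p.1)) with h3 | h3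
    · obtain ⟨h4, h5⟩ := h1.image_left h hw0.le
      refine ⟨_, _, h4, ?_, by nlinarith, Or.inr rfl⟩
      exact (segment_subset_image_left h0.2.le hw0.le).trans
        (image_mono ((convex_segment p q).segment_subset (left_mem_segment ℝ p q) hw))
    · obtain ⟨h4, h5⟩ := h2.image_right h hw0.ge
      refine ⟨_, _, h4, ?_, by nlinarith, Or.inr rfl⟩
      exact (segment_subset_image_right h0.1.le hw0.ge).trans
        (image_mono ((convex_segment p q).segment_subset (right_mem_segment ℝ p q) hw))
  obtain ⟨p₁, q₁, H₁, hs, hlen, hend⟩ := key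
  rcases H₁.grow_of_cut h hla hlr h1.right_mem hw0 hend with ⟨p', q', h3, h4⟩ | ⟨p', q', h3, h4, h5⟩
  · exact Or.inl ⟨1, p', q', h3, h4.trans hs⟩
  · refine Or.inr ⟨2, p', q', h3, iterate_subset (n := 1) h4 hs, ?_⟩
    nlinarith [mul_le_mul_of_nonneg_left hlen hl.le]

/-- Some iterate of a cone segment crosses the stable line. -/
lemma ConeSeg.exists_crossing (h : Admissible a b r c) {p q : ℝ × ℝ} (H : ConeSeg a b r c p q) :
    ∃ n p' q', Crossing a b r c p' q' ∧ segment ℝ p' q' ⊆ (F a b r c)^[n] '' segment ℝ p q := by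
  by_contra hcon
  have hl1 : 1 < min a r := lt_min h.one_lt_a h.one_lt_r
  have hl2 : 2 < (min a r) ^ 2 := by
    rcases min_choice a r with e | e <;> rw [e]
    exacts [h.two_lt_a_sq, h.two_lt_r_sq]
  set l := min a r with hl
  -- The gain is at least `l` in one step without a cut and at least `l ^ 2 / 2` in two steps with
  -- one.
  have hk : 1 < min l (l ^ 2 / 2) := lt_min hl1 (by linarith)
  set k := min l (l ^ 2 / 2) with hk'
  have grow : ∀ m : ℕ, ∃ n p' q', ConeSeg a b r c p' q' ∧
      segment ℝ p' q' ⊆ (F a b r c)^[n] '' segment ℝ p q ∧ k ^ m * (q.1 - p.1) ≤ q'.1 - p'.1 := by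
    intro m
    induction m with
    | zero => exact ⟨0, p, q, H, by simp, by simp⟩
    | succ m ih =>
      obtain ⟨n, p', q', h1, h2, h3⟩ := ih
      rcases h1.grow h (l := l) (k := k) (by linarith) (min_le_left _ _) (min_le_right _ _)
        (min_le_left _ _) (by linarith [min_le_right l (l ^ 2 / 2)])
        with ⟨n', p'', q'', h4, h5⟩ | ⟨n', p'', q'', h4, h5, h6⟩
      · refine absurd ⟨n' + n, p'', q'', h4, ?_⟩ hcon
        rw [Function.iterate_add, image_comp]
        exact h5.trans (image_mono h2)
      · refine ⟨n' + n, p'', q'', h4, ?_, ?_⟩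
        · rw [Function.iterate_add, image_comp]
          exact h5.trans (image_mono h2)
        · calc k ^ (m + 1) * (q.1 - p.1) = k * (k ^ m * (q.1 - p.1)) := by ring
            _ ≤ k * (q'.1 - p'.1) := by gcongr
            _ ≤ _ := h6
  have hd := sub_pos.2 H.lt
  obtain ⟨m, hm⟩ := pow_unbounded_of_one_lt
    ((1 / (1 - b) + (a / (a - 1) + b / (1 - b)) / (a - b)) / (q.1 - p.1)) hk
  obtain ⟨n, p', q', h1, -, h3⟩ := grow m
  rw [div_lt_iff₀ hd] at hm
  have h4 := le_fst_of_mem_trap h h1.left_mem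
  have h5 : q'.1 ≤ 1 / (1 - b) := by
    rw [le_div_iff₀ (by linarith [h.b_lt])]
    linarith [fst_le_of_mem_trap h h1.right_mem]
  rw [neg_div] at h4
  linarith

/-! ### Accumulation on the unstable line and transitivity -/

/-- Images of a segment that crosses the stable line accumulate on the unstable line near `X`. -/
lemma Crossing.eventually_meets (h : Admissible a b r c) {p q : ℝ × ℝ}
    (H : Crossing a b r c p q) : ∃ ε > 0, ∀ s, |s| < ε → ∀ N ∈ 𝓝 (P r c s 0),
      ∀ᶠ k in atTop, ∃ z ∈ segment ℝ p q, (F a b r c)^[k] z ∈ N := by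
  obtain ⟨hp, hq, hp0, hq0, hpξ, hqξ⟩ := H
  have hcr := h.c_lt_r
  have hr := h.one_lt_r
  have hx := x₀_pos h
  set s₀ := ξ r c p
  set s₁ := ξ r c q
  -- In eigencoordinates the segment is the graph of `t₀ + κ * s` over `[s₀, s₁]`.
  set κ := (η r c q - η r c p) / (s₁ - s₀) with hκ
  set t₀ := η r c p - κ * s₀ with ht₀
  have hd : 0 < s₁ - s₀ := by linarith
  have e1 : η r c p = t₀ + κ * s₀ := by rw [ht₀]; ring
  have e2 : η r c q = t₀ + κ * s₁ := by rw [ht₀, hκ]; field_simp; ring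
  have hseg : ∀ s, s₀ ≤ s → s ≤ s₁ → P r c s (t₀ + κ * s) ∈ segment ℝ p q := by
    intro s h0 h1
    have huv : (s₁ - s) / (s₁ - s₀) + (s - s₀) / (s₁ - s₀) = 1 := by field_simp; ring
    refine ⟨(s₁ - s) / (s₁ - s₀), (s - s₀) / (s₁ - s₀), div_nonneg (by linarith) hd.le,
      div_nonneg (by linarith) hd.le, huv, ?_⟩
    rw [← P_ξ_η hcr p, ← P_ξ_η hcr q, P_combo _ _ _ _ _ _ huv, e1, e2]
    congr 1 <;> field_simp <;> ring
  have hw : P r c 0 t₀ ∈ segment ℝ p q := by simpa using hseg 0 hpξ.le hqξ.le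
  obtain ⟨k1, k2⟩ := stable_of_mem_trap h (convex_trap.segment_subset hp hq hw) (by
    have : Convex ℝ {z : ℝ × ℝ | 0 ≤ z.1} := by
      intro u hu v hv s t hs ht _
      simp only [mem_ofPred_eq, Prod.fst_add, Prod.smul_fst, smul_eq_mul] at *
      positivity
    simpa [P] using this.segment_subset hp0 hq0 hw)
  -- A lower bound for `x` along the whole forward orbit of the crossing point `P 0 t₀`.
  set μ := min (x₀ r c) (min (x₀ r c + t₀) (x₀ r c - c * t₀)) with hμ
  have hμ0 : 0 < μ := lt_min hx (lt_min k1 k2)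
  have m1 : μ ≤ x₀ r c := min_le_left _ _
  have m2 : μ ≤ x₀ r c + t₀ := (min_le_right _ _).trans (min_le_left _ _)
  have m3 : μ ≤ x₀ r c - c * t₀ := (min_le_right _ _).trans (min_le_right _ _)
  -- The first bound keeps the starting points on the segment. The second keeps `k` steps of their
  -- orbits in `x ≥ 0`, since they deviate in `x` from the orbit of `P 0 t₀` by at most `(1 + |κ|) *
  -- |s| < μ`.
  refine ⟨min (min (-s₀) s₁) (μ / (1 + |κ|)),
    lt_min (lt_min (by linarith) hqξ) (by positivity), fun s hs N hN => ?_⟩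
  simp only [lt_min_iff] at hs
  obtain ⟨⟨l1, l2⟩, l3⟩ := hs
  rw [lt_div_iff₀ (by positivity)] at l3
  -- The starting coordinate that `k` steps carry exactly to `s`.
  set σ : ℕ → ℝ := fun k => s / (-r) ^ k with hσ
  have hσj : ∀ k, ∀ j ≤ k, |(-r) ^ j * σ k| ≤ |s| := by
    intro k j hj
    rw [hσ, abs_mul, abs_div, abs_pow, abs_pow, abs_neg, abs_of_pos (show 0 < r by linarith),
      mul_div_assoc', div_le_iff₀ (by positivity), mul_comm]
    exact mul_le_mul_of_nonneg_left (pow_le_pow_right₀ hr.le hj) (abs_nonneg s)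
  have hσ0 : ∀ k, |σ k| ≤ |s| := fun k => by simpa using hσj k 0 (Nat.zero_le k)
  have hlim : Tendsto (fun k => P r c s ((-c) ^ k * (t₀ + κ * σ k))) atTop (𝓝 (P r c s 0)) := by
    have l4 : Tendsto (fun k => (-c) ^ k * (t₀ + κ * σ k)) atTop (𝓝 0) := by
      have := (tendsto_neg_c_pow h 1).mul
        (((tendsto_div_neg_r_pow h s).const_mul κ).const_add t₀)
      simpa using this
    exact ((continuous_P (r := r) (c := c)).tendsto (s, 0)).comp (tendsto_const_nhds.prodMk_nhds l4)
  filter_upwards [hlim hN] with k hk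
  have l5 := abs_le.1 (hσ0 k)
  refine ⟨P r c (σ k) (t₀ + κ * σ k), hseg _ (by linarith) (by linarith), ?_⟩
  rw [iterate_F_P h k]
  · have : (-r) ^ k * σ k = s := by
      have : (-r) ^ k ≠ 0 := pow_ne_zero _ (by linarith)
      simp only [hσ]; field_simp
    rwa [this]
  · intro j hj
    have l6 := neg_le_of_abs_le (hσj k j hj.le)
    have l7 := le_neg_pow_mul h (m := μ - x₀ r c) (t := t₀) (by linarith) (by linarith)
      (by linarith) j
    have l8 : |(-c) ^ j * (κ * σ k)| ≤ |κ| * |s| := by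
      rw [abs_mul, abs_mul, abs_pow, abs_neg, abs_of_pos h.c_pos]
      have := pow_le_one₀ h.c_pos.le h.c_lt.le (n := j)
      calc c ^ j * (|κ| * |σ k|) ≤ 1 * (|κ| * |s|) :=
            mul_le_mul this (mul_le_mul_of_nonneg_left (hσ0 k) (abs_nonneg κ)) (by positivity)
              zero_le_one
        _ = _ := one_mul _
    have l9 := neg_le_of_abs_le l8
    nlinarith

/-- The part of the unstable line near `X` lies in every forward invariant set that contains the
segment from `X` to `T`. -/
lemma P_mem_of_segment_subset (h : Admissible a b r c) {S : Set (ℝ × ℝ)}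
    (hS : MapsTo (F a b r c) S S) (hT : segment ℝ (P r c 0 0) (Tpt r c) ⊆ S) {s : ℝ}
    (hs : |s| ≤ r * x₀ r c) : P r c s 0 ∈ S := by
  have hr := h.one_lt_r
  have hx := x₀_pos h
  have hrx : 0 < r * x₀ r c := by positivity
  have hpos : ∀ s, 0 ≤ s → s ≤ r * x₀ r c → P r c s 0 ∈ S := by
    intro s h0 h1
    have huv : (1 - s / (r * x₀ r c)) + s / (r * x₀ r c) = 1 := by ring
    refine hT ⟨1 - s / (r * x₀ r c), s / (r * x₀ r c), ?_, by positivity, huv, ?_⟩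
    · rw [sub_nonneg, div_le_one hrx]; exact h1
    · rw [Tpt, P_combo _ _ _ _ _ _ huv]
      congr 1
      · field_simp; ring
      · ring
  rw [abs_le] at hs
  rcases le_total 0 s with h0 | h0
  · exact hpos s h0 hs.2
  -- The eigenvalue `-r` is negative, so this half of the line is the image of the other.
  · have h1 : 0 ≤ -s / r := div_nonneg (by linarith) (by linarith)
    have h2 : -s / r ≤ r * x₀ r c := by
      rw [div_le_iff₀ (by linarith)]
      nlinarith
    have e : P r c s 0 = F a b r c (P r c (-s / r) 0) := by
      rw [F_P h (by linarith)]
      congr 1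
      · field_simp
      · ring
    rw [e]
    exact hS (hpos _ h1 h2)

lemma P_mem_trap (h : Admissible a b r c) {s : ℝ} (hs : |s| ≤ r * x₀ r c) :
    P r c s 0 ∈ trap a b r c :=
  P_mem_of_segment_subset h (mapsTo_trap h)
    (convex_trap.segment_subset (X_mem_trap h) (Tpt_mem_trap h)) hs

/-- Open sets that meet the unstable manifold are joined by orbits in it. -/
lemma exists_iterate_mem (h : Admissible a b r c) {S M N : Set (ℝ × ℝ)}
    (hWS : Wu (F a b r c) (X (-(r + c)) (r * c)) ⊆ S)
    (hSW : S ⊆ closure (Wu (F a b r c) (X (-(r + c)) (r * c))))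
    (hM : IsOpen M) (hN : IsOpen N) (hSM : (S ∩ M).Nonempty) (hSN : (S ∩ N).Nonempty) :
    ∃ n : ℕ, ((F a b r c)^[n] '' (S ∩ M) ∩ (S ∩ N)).Nonempty := by
  have hcr := h.c_lt_r
  have hr := h.one_lt_r
  have hb := h.b_pos
  have hc := h.c_pos
  have hx := x₀_pos h
  have hrx : x₀ r c < r * x₀ r c := by nlinarith
  have meets : ∀ U, IsOpen U → (S ∩ U).Nonempty →
      ∃ z ∈ U, z ∈ Wu (F a b r c) (X (-(r + c)) (r * c)) := by
    rintro U hU ⟨z, hz, hzU⟩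
    exact mem_closure_iff.1 (hSW hz) U hU hzU
  obtain ⟨z, hzM, hz⟩ := meets M hM hSM
  obtain ⟨y, hyN, hy⟩ := meets N hN hSN
  obtain ⟨n, s, hs, rfl⟩ := exists_of_mem_Wu h hz hx
  have hF : ∀ k, Continuous (F a b r c)^[k] := fun k => continuous_F.iterate k
  have hPs : Continuous fun s : ℝ => P r c s 0 :=
    (continuous_P (r := r) (c := c)).comp (continuous_id.prodMk continuous_const)
  obtain ⟨ε, hε, hball⟩ := Metric.isOpen_iff.1 ((hM.preimage (hF n)).preimage hPs) s hzM
  obtain ⟨e, he, heε, he1⟩ : ∃ e > 0, e < ε ∧ e ≤ r * x₀ r c - x₀ r c :=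
    ⟨min (ε / 2) (r * x₀ r c - x₀ r c), lt_min (by linarith) (by linarith),
      (min_le_left _ _).trans_lt (by linarith), min_le_right _ _⟩
  have hs' := abs_lt.1 hs
  have hJ : ∀ z ∈ segment ℝ (P r c s 0) (P r c (s + e) 0),
      z ∈ Wu (F a b r c) (X (-(r + c)) (r * c)) ∧ (F a b r c)^[n] z ∈ M := by
    rintro _ ⟨u, v, hu, hv, huv, rfl⟩
    rw [P_combo _ _ _ _ _ _ huv]
    obtain rfl : u = 1 - v := by linarith
    have e1 : (1 - v) * s + v * (s + e) = s + v * e := by ring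
    have e2 : (1 - v) * 0 + v * 0 = (0 : ℝ) := by ring
    have h0 : 0 ≤ v * e := by positivity
    have h1 : v * e ≤ e := by nlinarith
    rw [e1, e2]
    refine ⟨P_mem_Wu h (abs_le.2 ⟨by linarith, by linarith⟩), ?_⟩
    refine @hball (s + v * e) ?_
    rw [Metric.mem_ball, Real.dist_eq, abs_lt]
    constructor <;> linarith
  have H : ConeSeg a b r c (P r c s 0) (P r c (s + e) 0) := by
    refine ⟨P_mem_trap h (by linarith), P_mem_trap h (abs_le.2 ⟨by linarith, by linarith⟩), ?_, ?_,
      ?_⟩ <;> simp only [P]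
    · linarith
    · nlinarith [mul_pos hb he, mul_pos hc he]
    · linarith
  obtain ⟨m, p, q, hpq, hsub⟩ := H.exists_crossing h
  obtain ⟨ε', hε', hev⟩ := hpq.eventually_meets h
  obtain ⟨n', s', hs'', rfl⟩ := exists_of_mem_Wu h hy hε'
  -- The first `n` steps only lead from the unstable line near `X` to `M`. The time from `M` to `N`
  -- is what remains, hence `k ≥ n`.
  obtain ⟨k, ⟨w, hw, hwN⟩, hk⟩ := ((hev s' hs'' _ ((hN.preimage (hF n')).mem_nhds hyN)).and
    (eventually_ge_atTop n)).exists
  obtain ⟨w, hwJ, rfl⟩ := hsub hw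
  obtain ⟨h1, h2⟩ := hJ w hwJ
  refine ⟨n' + (k - n) + m, (F a b r c)^[n' + (k - n) + m] ((F a b r c)^[n] w),
    ⟨_, ⟨hWS (mapsTo_Wu.iterate n h1), h2⟩, rfl⟩,
    hWS (mapsTo_Wu.iterate _ (mapsTo_Wu.iterate n h1)), ?_⟩
  rw [← Function.iterate_add_apply, show n' + (k - n) + m + n = n' + (k + m) by lia,
    Function.iterate_add_apply, Function.iterate_add_apply _ k m]
  exact hwN

/-! ### Area contraction and the closure of the unstable manifold -/

open MeasureTheory

lemma volume_image_affine (τ δ : ℝ) (hδ : 0 ≤ δ) (S : Set (ℝ × ℝ)) :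
    volume ((fun z => A τ δ z + (1, 0)) '' S) = ENNReal.ofReal δ * volume S := by
  set M : (ℝ × ℝ) →ₗ[ℝ] ℝ × ℝ :=
    Matrix.toLin (Module.Basis.finTwoProd ℝ) (Module.Basis.finTwoProd ℝ) !![τ, 1; -δ, 0] with hM
  have e : (fun z => A τ δ z + (1, 0)) = (fun z => z + ((1, 0) : ℝ × ℝ)) ∘ M := by
    funext z
    simp [hM, Matrix.toLin_finTwoProd_apply, A]
  have hdet : LinearMap.det M = δ := by
    rw [hM, LinearMap.det_toLin, Matrix.det_fin_two_of]; ring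
  rw [e, image_comp, image_add_right, measure_preimage_add_right,
    Measure.addHaar_image_linearMap, hdet, abs_of_nonneg hδ]

lemma volume_image_F_le (h : Admissible a b r c) (S : Set (ℝ × ℝ)) :
    volume (F a b r c '' S) ≤ ENNReal.ofReal (max (a * b) (r * c)) * volume S := by
  have ha := h.one_lt_a
  have hr := h.one_lt_r
  have hb := h.b_pos
  have hc := h.c_pos
  have hmeas : MeasurableSet {z : ℝ × ℝ | z.1 ≤ 0} := measurableSet_le measurable_fst measurable_const
  have hsub : F a b r c '' S ⊆ (fun z => A (a + b) (a * b) z + (1, 0)) '' (S ∩ {z | z.1 ≤ 0}) ∪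
      (fun z => A (-(r + c)) (r * c) z + (1, 0)) '' (S \ {z | z.1 ≤ 0}) := by
    rintro _ ⟨z, hz, rfl⟩
    by_cases h0 : z.1 ≤ 0
    · exact Or.inl ⟨z, ⟨hz, h0⟩, by simp [F, f, h0]⟩
    · exact Or.inr ⟨z, ⟨hz, h0⟩, by simp [F, f, h0]⟩
  refine (measure_mono hsub).trans ((measure_union_le _ _).trans ?_)
  rw [volume_image_affine _ _ (by positivity), volume_image_affine _ _ (by positivity),
    ← measure_inter_add_sdiff S hmeas, mul_add]
  gcongr
  exacts [le_max_left _ _, le_max_right _ _]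

lemma volume_image_iterate_F_le (h : Admissible a b r c) (S : Set (ℝ × ℝ)) (n : ℕ) :
    volume ((F a b r c)^[n] '' S) ≤ ENNReal.ofReal (max (a * b) (r * c)) ^ n * volume S := by
  induction n with
  | zero => simp
  | succ n ih =>
    rw [Function.iterate_succ', image_comp, pow_succ', mul_assoc]
    exact (volume_image_F_le h _).trans (by gcongr)

lemma isClosed_image_iterate_F (h : Admissible a b r c) {S : Set (ℝ × ℝ)} (hS : IsClosed S)
    (n : ℕ) : IsClosed ((F a b r c)^[n] '' S) := by
  induction n with
  | zero => simpa
  | succ n ih =>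
    rw [Function.iterate_succ', image_comp, ← coe_homeoF h, (homeoF h).isClosed_image]
    exact ih

lemma frontier_image_iterate_F (h : Admissible a b r c) (S : Set (ℝ × ℝ)) (n : ℕ) :
    frontier ((F a b r c)^[n] '' S) = (F a b r c)^[n] '' frontier S := by
  induction n with
  | zero => simp
  | succ n ih =>
    rw [Function.iterate_succ', image_comp, ← coe_homeoF h, ← (homeoF h).image_frontier,
      coe_homeoF, ih, image_comp]

lemma ξ_combo (hcr : c < r) {u v : ℝ} (p q : ℝ × ℝ) (huv : u + v = 1) :
    ξ r c (u • p + v • q) = u * ξ r c p + v * ξ r c q := by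
  nth_rewrite 1 [← P_ξ_η hcr p, ← P_ξ_η hcr q]
  rw [P_combo _ _ _ _ _ _ huv, ξ_P hcr]

lemma η_combo (hcr : c < r) {u v : ℝ} (p q : ℝ × ℝ) (huv : u + v = 1) :
    η r c (u • p + v • q) = u * η r c p + v * η r c q := by
  nth_rewrite 1 [← P_ξ_η hcr p, ← P_ξ_η hcr q]
  rw [P_combo _ _ _ _ _ _ huv, η_P hcr]

/-- A triangle with vertices at `X` and on the two eigenlines, in eigencoordinates. -/
lemma convexHull_eq (hcr : c < r) {m t : ℝ} (hm : 0 < m) (ht : 0 < t) :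
    convexHull ℝ {P r c 0 0, P r c m 0, P r c 0 t} =
      {z | 0 ≤ ξ r c z ∧ 0 ≤ η r c z ∧ ξ r c z / m + η r c z / t ≤ 1} := by
  refine (convexHull_min ?_ ?_).antisymm fun z hz => ?_
  · rintro z (rfl | rfl | rfl) <;>
      simp [ξ_P hcr, η_P hcr, hm.le, ht.le, hm.ne', ht.ne']
  · rintro p ⟨p1, p2, p3⟩ q ⟨q1, q2, q3⟩ u v hu hv huv
    rw [mem_ofPred_eq, ξ_combo hcr _ _ huv, η_combo hcr _ _ huv]
    refine ⟨by positivity, by positivity, ?_⟩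
    calc _ = u * (ξ r c p / m + η r c p / t) + v * (ξ r c q / m + η r c q / t) := by ring
      _ ≤ u * 1 + v * 1 := by gcongr
      _ = 1 := by linarith
  · obtain ⟨h1, h2, h3⟩ := hz
    have e := (convex_convexHull ℝ {P r c 0 0, P r c m 0, P r c 0 t}).sum_mem
      (t := (Finset.univ : Finset (Fin 3)))
      (w := ![1 - ξ r c z / m - η r c z / t, ξ r c z / m, η r c z / t])
      (z := ![P r c 0 0, P r c m 0, P r c 0 t])
      (by
        intro i _
        fin_cases i
        · simp; linarith
        · simp; positivity
        · simp; positivity)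
      (by simp [Fin.sum_univ_three]; ring)
      (by
        intro i _
        refine subset_convexHull ℝ _ ?_
        fin_cases i <;> simp)
    convert e using 1
    nth_rewrite 1 [← P_ξ_η hcr z]
    simp only [Fin.sum_univ_three, P]
    ext <;> simp <;> field_simp <;> ring

/-- The boundary of the triangle consists of points on the eigenlines and of the side opposite
to `X`. -/
lemma frontier_convexHull_subset (hcr : c < r) {m t : ℝ} (hm : 0 < m) (ht : 0 < t) :
    frontier (convexHull ℝ {P r c 0 0, P r c m 0, P r c 0 t}) ⊆
      {z | ∃ s, 0 ≤ s ∧ s ≤ m ∧ z = P r c s 0} ∪ {z | ∃ s, 0 ≤ s ∧ s ≤ t ∧ z = P r c 0 s} ∪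
        segment ℝ (P r c m 0) (P r c 0 t) := by
  rw [convexHull_eq hcr hm ht]
  set D := {z | 0 ≤ ξ r c z ∧ 0 ≤ η r c z ∧ ξ r c z / m + η r c z / t ≤ 1} with hD
  have cξ := continuous_ξ (r := r) (c := c)
  have cη := continuous_η (r := r) (c := c)
  have cs : Continuous fun z => ξ r c z / m + η r c z / t := by fun_prop
  have hcl : IsClosed D := (isClosed_le continuous_const cξ).inter
    ((isClosed_le continuous_const cη).inter (isClosed_le cs continuous_const))
  have hop : IsOpen {z | 0 < ξ r c z ∧ 0 < η r c z ∧ ξ r c z / m + η r c z / t < 1} :=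
    (isOpen_lt continuous_const cξ).inter
    ((isOpen_lt continuous_const cη).inter (isOpen_lt cs continuous_const))
  have hint := interior_maximal (s := D) (fun z hz => ⟨hz.1.le, hz.2.1.le, hz.2.2.le⟩) hop
  intro z hz
  rw [hcl.frontier_eq] at hz
  obtain ⟨⟨h1, h2, h3⟩, h4⟩ := hz
  rcases h1.eq_or_lt with k1 | k1
  · refine Or.inl (Or.inr ⟨η r c z, h2, ?_, by rw [k1, P_ξ_η hcr]⟩)
    rwa [← k1, zero_div, zero_add, div_le_one ht] at h3
  rcases h2.eq_or_lt with k2 | k2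
  · refine Or.inl (Or.inl ⟨ξ r c z, h1, ?_, by rw [k2, P_ξ_η hcr]⟩)
    rwa [← k2, zero_div, add_zero, div_le_one hm] at h3
  rcases h3.eq_or_lt with k3 | k3
  · refine Or.inr ⟨ξ r c z / m, η r c z / t, by positivity, by positivity, k3, ?_⟩
    rw [P_combo _ _ _ _ _ _ k3]
    conv_rhs => rw [← P_ξ_η hcr z]
    congr 1 <;> field_simp <;> ring
  · exact absurd (hint ⟨k1, k2, k3⟩) h4

lemma mapsTo_forwardUnion (g : ℝ × ℝ → ℝ × ℝ) (S : Set (ℝ × ℝ)) :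
    MapsTo g (forwardUnion g S) (forwardUnion g S) := by
  intro z hz
  obtain ⟨n, w, hw, rfl⟩ := mem_iUnion.1 hz
  exact mem_iUnion.2 ⟨n + 1, w, hw, Function.iterate_succ_apply' g n w⟩

lemma mapsTo_forwardInter {g : ℝ × ℝ → ℝ × ℝ} {S : Set (ℝ × ℝ)} (hS : MapsTo g S S) :
    MapsTo g (forwardInter g S) (forwardInter g S) := by
  intro z hz
  refine mem_iInter.2 fun n => ?_
  obtain ⟨w, hw, rfl⟩ := mem_iInter.1 hz n
  exact ⟨g w, hS hw, (Function.iterate_succ_apply g n w).symm.trans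
    (Function.iterate_succ_apply' g n w)⟩

lemma Wu_subset_forwardUnion (h : Admissible a b r c) {t : ℝ} : Wu (F a b r c) (X (-(r + c)) (r * c)) ⊆
    forwardUnion (F a b r c) (convexHull ℝ {P r c 0 0, Tpt r c, P r c 0 t}) := by
  intro z hz
  have hr := h.one_lt_r
  have hx := x₀_pos h
  obtain ⟨n, s, hs, rfl⟩ := exists_of_mem_Wu h hz (show 0 < r * x₀ r c by positivity)
  refine (mapsTo_forwardUnion _ _).iterate n
    (P_mem_of_segment_subset h (mapsTo_forwardUnion _ _) ?_ hs.le)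
  refine Subset.trans ?_ (subset_iUnion _ 0)
  rw [Function.iterate_zero, image_id]
  exact segment_subset_convexHull (by simp) (by simp)

lemma Wu_subset_forwardInter (h : Admissible a b r c) {t : ℝ} : Wu (F a b r c) (X (-(r + c)) (r * c)) ⊆
    forwardInter (F a b r c)
      (forwardUnion (F a b r c) (convexHull ℝ {P r c 0 0, Tpt r c, P r c 0 t})) := by
  refine subset_iInter fun n => ?_
  rw [← image_iterate_Wu n]
  exact image_mono (Wu_subset_forwardUnion h)

/-- A preconnected set that meets a set but not its boundary is contained in it. -/
lemma subset_of_disjoint_frontier {s u : Set (ℝ × ℝ)} (hs : IsPreconnected s)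
    (hsu : Disjoint s (frontier u)) (hne : (s ∩ u).Nonempty) : s ⊆ u := by
  have key : ∀ z ∈ s, z ∈ closure u → z ∈ interior u := fun z hz hzu => by
    by_contra hcon
    exact disjoint_left.1 hsu hz ⟨hzu, hcon⟩
  refine (hs.subset_left_of_subset_union isOpen_interior isClosed_closure.isOpen_compl
    (disjoint_left.2 fun z hz hz' => hz' (interior_subset_closure hz)) (fun z hz => ?_)
    (hne.mono fun z hz => ⟨hz.1, key z hz.1 (subset_closure hz.2)⟩)).trans interior_subset
  by_cases hzu : z ∈ closure u
  exacts [Or.inl (key z hz hzu), Or.inr hzu]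

/-- The images of the boundary of the triangle shrink to the unstable manifold, and the area of
the images of the triangle shrinks to `0`. -/
lemma forwardInter_closure_subset (h : Admissible a b r c) {t : ℝ} (ht : 0 < t)
    (ht' : 0 ≤ x₀ r c - c * t)
    (hZ : P r c 0 t ∈ segment ℝ (Tpt r c) (F a b r c (F a b r c (Tpt r c)))) :
    forwardInter (F a b r c)
        (closure (forwardUnion (F a b r c) (convexHull ℝ {P r c 0 0, Tpt r c, P r c 0 t}))) ⊆
      closure (Wu (F a b r c) (X (-(r + c)) (r * c))) := by
  have hr := h.one_lt_r
  have hc := h.c_pos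
  have hx := x₀_pos h
  have hcr := h.c_lt_r
  have hm : 0 < r * x₀ r c := by positivity
  intro z hz
  by_contra hzW
  set W := Wu (F a b r c) (X (-(r + c)) (r * c)) with hW
  set D := convexHull ℝ {P r c 0 0, Tpt r c, P r c 0 t} with hD
  obtain ⟨ε, hε, hball⟩ := Metric.isOpen_iff.1 isClosed_closure.isOpen_compl z hzW
  have hX : P r c 0 0 ∈ W := P_mem_Wu h (by simpa using hm.le)
  have hXz : P r c 0 0 ∈ (Metric.closedBall z (ε / 2))ᶜ := fun k =>
    hball (Metric.closedBall_subset_ball (by linarith) k) (subset_closure hX)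
  have hV : Disjoint (Metric.ball z (ε / 2)) W := by
    rw [disjoint_left]
    exact fun w hw hwW => hball (Metric.ball_subset_ball (by linarith) hw) (subset_closure hwW)
  have hPt : Continuous fun s : ℝ => P r c 0 s :=
    (continuous_P (r := r) (c := c)).comp (continuous_const.prodMk continuous_id)
  -- Points of the stable line within `δ` of `X` in the stable coordinate avoid the ball.
  obtain ⟨δ, hδ, hPδ⟩ := Metric.isOpen_iff.1
    (Metric.isClosed_closedBall.isOpen_compl.preimage hPt) 0 hXz
  have ev1 : ∀ᶠ n : ℕ in atTop, c ^ n * t < δ := by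
    have : Tendsto (fun n : ℕ => c ^ n * t) atTop (𝓝 (0 * t)) :=
      (tendsto_pow_atTop_nhds_zero_of_lt_one hc.le h.c_lt).mul_const t
    rw [zero_mul] at this
    exact this.eventually_lt_const hδ
  have ev2 : ∀ᶠ n : ℕ in atTop, ENNReal.ofReal (max (a * b) (r * c)) ^ n * volume D <
      volume (Metric.ball z (ε / 2)) := by
    have hDfin : volume D ≠ ⊤ :=
      ((toFinite {P r c 0 0, Tpt r c, P r c 0 t}).isCompact_convexHull ℝ).measure_lt_top.ne
    have : Tendsto (fun n : ℕ => ENNReal.ofReal (max (a * b) (r * c)) ^ n * volume D) atTop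
        (𝓝 (0 * volume D)) :=
      ENNReal.Tendsto.mul_const (ENNReal.tendsto_pow_atTop_nhds_zero_of_lt_one (by
        rw [ENNReal.ofReal_lt_one]; exact max_lt h.ab_lt h.rc_lt)) (Or.inr hDfin)
    rw [zero_mul] at this
    exact this.eventually_lt_const (Metric.measure_ball_pos _ _ (by linarith))
  obtain ⟨n, hn⟩ := eventually_atTop.1 (ev1.and ev2)
  have hzn := mem_iInter.1 hz n
  obtain ⟨w, hwV, y, hy, rfl⟩ := mem_closure_iff.1
    (image_closure_subset_closure_image (continuous_F.iterate n) hzn) _ Metric.isOpen_ball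
    (Metric.mem_ball_self (show 0 < ε / 2 by linarith))
  obtain ⟨k, y, hyD, rfl⟩ := mem_iUnion.1 hy
  rw [← Function.iterate_add_apply] at hwV
  obtain ⟨hn1, hn2⟩ := hn (n + k) (by lia)
  have hfr : Disjoint (Metric.ball z (ε / 2)) (frontier ((F a b r c)^[n + k] '' D)) := by
    rw [disjoint_left]
    intro w hw hwf
    have hWn : ∀ v ∈ W, (F a b r c)^[n + k] v ∉ Metric.ball z (ε / 2) := fun v hv hv' =>
      disjoint_left.1 hV hv' (mapsTo_Wu.iterate (n + k) hv)
    rw [frontier_image_iterate_F h] at hwf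
    obtain ⟨v, hv, rfl⟩ := hwf
    rcases frontier_convexHull_subset hcr hm ht hv with (⟨s, h0, h1, rfl⟩ | ⟨s, h0, h1, rfl⟩) | hv
    · exact hWn _ (P_mem_Wu h (abs_le.2 ⟨by linarith, h1⟩)) hw
    · rw [iterate_F_stable h (by linarith) (by nlinarith)] at hw
      refine @hPδ ((-c) ^ (n + k) * s) ?_ (Metric.ball_subset_closedBall hw)
      rw [Metric.mem_ball, dist_zero_right, Real.norm_eq_abs, abs_mul, abs_pow, abs_neg,
        abs_of_pos hc, abs_of_nonneg h0]
      exact lt_of_le_of_lt (by gcongr) hn1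
    · exact hWn _ (segment_subset_Wu h
        ((convex_segment _ _).segment_subset (left_mem_segment _ _ _) hZ hv)) hw
  -- The ball is connected, meets the image of the triangle and misses its boundary, so it lies
  -- inside, against the area bound.
  have hsub := subset_of_disjoint_frontier (convex_ball z (ε / 2)).isPreconnected hfr
    ⟨_, hwV, mem_image_of_mem _ hyD⟩
  exact absurd ((measure_mono hsub).trans (volume_image_iterate_F_le h D _)) (not_le.2 hn2)

lemma closure_Wu_subset (h : Admissible a b r c) {t : ℝ} :
    closure (Wu (F a b r c) (X (-(r + c)) (r * c))) ⊆ forwardInter (F a b r c)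
        (closure (forwardUnion (F a b r c) (convexHull ℝ {P r c 0 0, Tpt r c, P r c 0 t}))) := by
  refine closure_minimal ((Wu_subset_forwardInter h).trans
    (iInter_mono fun n => image_mono subset_closure)) ?_
  exact isClosed_iInter fun n => isClosed_image_iterate_F h isClosed_closure n

/-! ### From the given parameters to eigenvalues, and the conclusion -/

/-- The parameters of the normal form, expressed by the eigenvalues of its pieces. -/
lemma exists_admissible {τL δL τR δR : ℝ}
    (hδL : 0 < δL) (hδR : 0 < δR) (hτL : δL + 1 < τL) (hτR : τR < -(δR + 1))
    (hδL1 : δL < 1) (hδR1 : δR < 1) (hphi : 0 < phi τL δL τR δR)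
    (hτL2 : (δL + 2) / Real.sqrt 2 < τL) (hτR2 : τR < -((δR + 2) / Real.sqrt 2)) :
    ∃ a b r c, Admissible a b r c ∧ τL = a + b ∧ δL = a * b ∧ τR = -(r + c) ∧ δR = r * c := by
  have key : ∀ τ δ : ℝ, 0 < δ → δ + 1 < τ → (δ + 2) / Real.sqrt 2 < τ →
      ∃ l m, l = (τ + Real.sqrt (τ ^ 2 - 4 * δ)) / 2 ∧ 0 < m ∧ 1 < l ∧ 2 < l ^ 2 ∧ τ = l + m ∧
        δ = l * m := by
    intro τ δ hδ h1 h2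
    have hs : Real.sqrt 2 ^ 2 = 2 := Real.sq_sqrt (by norm_num)
    have hs0 : 0 < Real.sqrt 2 := by positivity
    rw [div_lt_iff₀ hs0] at h2
    have hd : (δ - 1) ^ 2 < τ ^ 2 - 4 * δ := by nlinarith
    have hq := Real.sq_sqrt ((sq_nonneg _).trans hd.le)
    set q := Real.sqrt (τ ^ 2 - 4 * δ)
    have hq0 : 0 ≤ q := Real.sqrt_nonneg _
    have hqτ : q < τ := by nlinarith
    have hprod : (τ + q) / 2 * ((τ - q) / 2) = δ := by linarith
    -- A point where the characteristic polynomial is negative lies below its larger root. The two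
    -- hypotheses on `τ` are this negativity at `1` and at `√2`.
    have hgt : ∀ s : ℝ, s ^ 2 - τ * s + δ < 0 → s < (τ + q) / 2 := by
      intro s hs
      by_contra hcon
      nlinarith
    have h3 := hgt 1 (by linarith)
    have h4 := hgt (Real.sqrt 2) (by linarith)
    exact ⟨(τ + q) / 2, (τ - q) / 2, rfl, by linarith, h3, by nlinarith, by ring, hprod.symm⟩
  obtain ⟨a, b, hla, hb, ha, ha2, rfl, rfl⟩ := key τL δL hδL hτL hτL2
  obtain ⟨r, c, -, hc, hr, hr2, hrc, rfl⟩ := key (-τR) δR hδR (by linarith) (by linarith)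
  obtain rfl : τR = -(r + c) := by linarith
  refine ⟨a, b, r, c, ⟨ha, hr, hb, hc, ha2, hr2, hδL1, hδR1, ?_⟩, rfl, rfl, rfl, rfl⟩
  rw [phi, lamLu, ← hla] at hphi
  linarith

end BorderCollision
open BorderCollision
theorem theorem2p2 (τL δL τR δR : ℝ)
    (hδL : 0 < δL) (hδR : 0 < δR) (hτL : δL + 1 < τL) (hτR : τR < -(δR + 1))
    (hδL1 : δL < 1) (hδR1 : δR < 1) (hphi : 0 < phi τL δL τR δR)
    (hτL2 : (δL + 2) / Real.sqrt 2 < τL) (hτR2 : τR < -((δR + 2) / Real.sqrt 2)) :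
    ∃ T Z : ℝ × ℝ,
      -- `T` is the intersection of `Eᵘ(X)` with the line `y = 0`
      Eu τR δR ∩ {z | z.2 = 0} = {T} ∧
      -- (i) `f²(T)` lies to the left of `Eˢ(X)`, and a transverse homoclinic point `Z` exists
      LiesLeftOf ((f τL δL τR δR)^[2] T) (Es τR δR) ∧
      segment ℝ T ((f τL δL τR δR)^[2] T) ∩ Es τR δR = {Z} ∧
      IsTransverseHomoclinic (f τL δL τR δR) (X τR δR) Z ∧
      -- (ii) with `Δ = ⋃ₙ fⁿ(triangle XTZ)`: both `⋂ₙ fⁿ(cl Δ)` and `cl (⋂ₙ fⁿ(Δ))` are `cl Wᵘ(X)`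
      forwardInter (f τL δL τR δR)
          (closure (forwardUnion (f τL δL τR δR) (convexHull ℝ {X τR δR, T, Z}))) =
        closure (Wu (f τL δL τR δR) (X τR δR)) ∧
      closure (forwardInter (f τL δL τR δR)
          (forwardUnion (f τL δL τR δR) (convexHull ℝ {X τR δR, T, Z}))) =
        closure (Wu (f τL δL τR δR) (X τR δR)) ∧
      -- (iii) `f` is transitive on `cl Wᵘ(X)`, and on `⋂ₙ fⁿ(Δ)`
      IsTransitiveOn (f τL δL τR δR) (closure (Wu (f τL δL τR δR) (X τR δR))) ∧
      IsTransitiveOn (f τL δL τR δR) (forwardInter (f τL δL τR δR)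
          (forwardUnion (f τL δL τR δR) (convexHull ℝ {X τR δR, T, Z}))) := by
  obtain ⟨a, b, r, c, h, rfl, rfl, rfl, rfl⟩ :=
    exists_admissible hδL hδR hτL hτR hδL1 hδR1 hphi hτL2 hτR2
  obtain ⟨u, v, t, hu, hv, huv, e, -, h1, h2, ht⟩ := exists_crossing h
  have hZ : P r c 0 t ∈ segment ℝ (Tpt r c) (F a b r c (F a b r c (Tpt r c))) :=
    ⟨u, v, hu.le, hv.le, huv, e⟩
  have hsub := forwardInter_closure_subset h ht h2.le hZ
  have hsub' : forwardInter (F a b r c)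
      (forwardUnion (F a b r c) (convexHull ℝ {P r c 0 0, Tpt r c, P r c 0 t})) ⊆
      closure (Wu (F a b r c) (X (-(r + c)) (r * c))) :=
    (iInter_mono fun n => image_mono subset_closure).trans hsub
  refine ⟨Tpt r c, P r c 0 t, Eu_inter h, liesLeftOf_Es h (ξ_F_F_Tpt h),
    segment_inter_Es h hu hv huv e, isTransverseHomoclinic h hu hv huv e h1 h2 ht, ?_⟩
  rw [← P_zero_zero h] at hsub hsub' ⊢
  have hW := Wu_subset_forwardInter h (t := t)
  have hW' := closure_Wu_subset h (t := t)
  rw [← P_zero_zero h] at hW hW'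
  have hcl : MapsTo (F a b r c) (closure (Wu (F a b r c) (P r c 0 0)))
      (closure (Wu (F a b r c) (P r c 0 0))) := mapsTo_Wu.closure continuous_F
  -- Transitivity holds for any invariant set between `Wu` and its closure, which covers both sets
  -- of (iii).
  have htrans := fun S M N => exists_iterate_mem h (S := S) (M := M) (N := N)
  rw [← P_zero_zero h] at htrans
  exact ⟨hsub.antisymm hW', (closure_minimal hsub' isClosed_closure).antisymm (closure_mono hW),
    ⟨hcl, fun M N hM hN => htrans _ M N subset_closure le_rfl hM hN⟩,
    ⟨mapsTo_forwardInter (mapsTo_forwardUnion _ _), fun M N hM hN => htrans _ M N hW hsub' hM hN⟩⟩
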